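/- Let $\mathbf t_n$ be a uniform random tree on the vertex set $[n]=\{1,\dots,n\}$ (uniform among the $n^{n-2}$ labelled trees), and let $\alpha>0$. Initially every edge of $\mathbf t_n$ is inflammable. Independently for different edges, an inflammable edge becomes fireproof at rate $1$, and a fire starts on it at rate $n^{-\alpha}$; when a fire starts on an inflammable edge, it instantaneously burns that edge and propagates through neighbouring inflammable edges, being stopped only at fireproof edges (fireproof and burnt edges never change state again). After a finite time every edge is either fireproof or burnt. A vertex is fireproof if all its adjacent edges are fireproof in this terminal state. The fireproof forest $\mathcal F_n$ is the graph whose vertices are the fireproof vertices and whose edges are the fireproof edges with two fireproof end-points; its connected components are called tree-components, and the size of a tree-component is its number of vertices. Fix $\varepsilon\in(0,1)$. (i) If $\alpha>1/2$, the probability that $\mathcal F_n$ has a tree-component of size greater than $(1-\varepsilon)n$ converges to $1$ as $n\to\infty$. (ii) If $\alpha=1/2$, the probability that $\mathcal F_n$ has a tree-component of size greater than $\varepsilon n$ converges to $0$ as $n\to\infty$. -/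

import Mathlib

open MeasureTheory ProbabilityTheory Filter Topology

namespace FireTree

/-- The three states of an edge. -/
inductive EdgeState
  | inflammable
  | fireproof
  | burnt

section Dynamics

/-! Fire dynamics on the edges of a finite graph `G`. The randomness is carried by two families of
clocks: `F e` is the time at which the edge `e` would become fireproof and `B e` is the time at
which a fire would start on `e`; a clock is only effective if its edge is still inflammable. -/

variable {V : Type*} [Fintype V] (G : SimpleGraph V) (F B : Sym2 V → ℝ)

/-- A fire on the edge `e` spreads directly to the edge `e'` if `e'` is inflammable and shares a
vertex with `e`. -/
def SpreadsTo (σ : G.edgeSet → EdgeState) (e e' : G.edgeSet) : Prop :=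
  σ e' = EdgeState.inflammable ∧ ∃ v : V, v ∈ (e : Sym2 V) ∧ v ∈ (e' : Sym2 V)

/-- In the configuration `σ`, the edge `e` is burnt by a fire at time `s`: there is an inflammable
edge `e₀` whose fire clock rings at time `s`, and the fire propagates from `e₀` to `e` along
neighbouring inflammable edges. -/
def CatchesFire (σ : G.edgeSet → EdgeState) (s : ℝ) (e : G.edgeSet) : Prop :=
  ∃ e₀ : G.edgeSet, σ e₀ = EdgeState.inflammable ∧ B e₀ = s ∧
    Relation.ReflTransGen (SpreadsTo G σ) e₀ e

open Classical in
/-- The configuration right after time `s`, when `σ` is the configuration right before time `s`. -/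
noncomputable def step (σ : G.edgeSet → EdgeState) (s : ℝ) : G.edgeSet → EdgeState := fun e =>
  if σ e = EdgeState.inflammable then
    if CatchesFire G B σ s e then EdgeState.burnt
    else if F e = s then EdgeState.fireproof
    else EdgeState.inflammable
  else σ e

open Classical in
/-- The finite set of times at which a clock of some edge of `G` rings. -/
noncomputable def ringTimes : Finset ℝ :=
  Finset.univ.image (fun e : G.edgeSet => F e) ∪ Finset.univ.image (fun e : G.edgeSet => B e)

/-- The terminal configuration: initially every edge is inflammable, and the clock rings are treated
in increasing order of time until all the clocks have rung. -/
noncomputable def terminalState : G.edgeSet → EdgeState :=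
  ((ringTimes G F B).sort (· ≤ ·)).foldl (step G F B) (fun _ => EdgeState.inflammable)

/-- A vertex is fireproof if all its adjacent edges are fireproof in the terminal configuration. -/
def IsFireproof (v : V) : Prop :=
  ∀ e : G.edgeSet, v ∈ (e : Sym2 V) → terminalState G F B e = EdgeState.fireproof

/-- The fireproof forest: its vertices are the fireproof vertices, its edges are the fireproof
edges of `G` between fireproof vertices. -/
def fireproofForest : SimpleGraph {v : V // IsFireproof G F B v} where
  Adj u v := ∃ h : s((u : V), (v : V)) ∈ G.edgeSet,
    terminalState G F B ⟨s((u : V), (v : V)), h⟩ = EdgeState.fireproof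
  symm := ⟨fun u v ⟨h, h'⟩ => by
    simp only [Sym2.eq_swap (a := (u : V))] at h h'
    exact ⟨h, h'⟩⟩
  loopless := ⟨fun u ⟨h, _⟩ => G.loopless.irrefl _ h⟩

/-- The fireproof forest has a tree-component with more than `x` vertices. -/
def HasComponentLargerThan (x : ℝ) : Prop :=
  ∃ C : (fireproofForest G F B).ConnectedComponent, x < (C.supp.ncard : ℝ)

end Dynamics

/-- Trees on the vertex set `Fin n` (Cayley trees with `n` vertices). -/
def CayleyTree (n : ℕ) : Type := {G : SimpleGraph (Fin n) // G.IsTree}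

instance (n : ℕ) : MeasurableSpace (CayleyTree n) := ⊤

/-- The sample space: a Cayley tree, the fireproofing clocks and the fire clocks. -/
abbrev Sample (n : ℕ) : Type := CayleyTree n × (Sym2 (Fin n) → ℝ) × (Sym2 (Fin n) → ℝ)

/-- The law of the model with parameter `α`: the tree is uniform on the Cayley trees with `n`
vertices, the fireproofing clocks are exponential with rate `1`, the fire clocks are exponential
with rate `n ^ (-α)`, and all of these are independent. -/
noncomputable def fireLaw (α : ℝ) (n : ℕ) : Measure (Sample n) :=
  (uniformOn (Set.univ : Set (CayleyTree n))).prod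
    ((Measure.pi fun _ : Sym2 (Fin n) => expMeasure 1).prod
      (Measure.pi fun _ : Sym2 (Fin n) => expMeasure ((n : ℝ) ^ (-α))))

/-- The event that the fireproof forest has a tree-component with more than `x` vertices. -/
def largeComponentEvent (n : ℕ) (x : ℝ) : Set (Sample n) :=
  {ω | HasComponentLargerThan ω.1.1 ω.2.1 ω.2.2 x}

end FireTree

/-! Both limits reduce to pairs of vertices. Two vertices of a tree lie in the same tree-component
exactly when the whole path between them is fireproof (`joined_of_fireproof`,
`fireproof_of_joined`). A component larger than εn gives at least ε²n² joined pairs, while if no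
component exceeds (1-ε)n, at least εn² pairs are not joined. Markov's inequality over pairs
(`fireLaw_le`) then leaves a question about the path between two uniform vertices of a uniform tree.

If this path has k vertices, the rest of the tree is a uniform forest rooted at them: cutting a
trail edge by edge is a bijection (`sumLevel_succ`), and Cayley's formula k n^(n-k-1)
(`card_forests`) counts the result. So k has an explicit law of order √n (`pathProb`), and cutting
further trails gives the first two moments of the numbers of vertices at given heights above the
path.

The dynamics are framed by two static criteria. An edge that is not fireproof is linked to some e₀
with B e₀ ≤ F e₀ through edges whose fireproofing clocks are at least B e₀
(`exposed_of_not_fireproof`); with strict inequalities such a link forces burning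
(`burnt_of_linked`). In a tree, a fire started at height h above the path thus has to beat the h
fireproofing clocks below it, which has probability at most r/h for fire rate r = n^(-α).

For α > 1/2 a union bound suffices: the path is hit with probability at most r (k + ∑ 1/height), of
mean O(r √n log n), which tends to 0.

For α = 1/2 only heights up to a constant H are used. A vertex w at height h is slow if its h
fireproofing clocks exceed 1/h, an event of probability 1/e; a fireproof path then forbids the fire
clock of w to ring by time 1/h. Given the fireproofing clocks this costs exp(-r Y), with Y the sum
of 1/h over slow vertices. A second moment bound (`sum_resistEvent_le`) shows that Y is rarely below
half of (k/e) ∑_{h ≤ H} 1/h. As r k is typically of order 1 and the harmonic series diverges, a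
large H makes the probability as small as desired. -/

namespace FireTree

set_option linter.unusedSectionVars false

/-! ### Rooted forests as parent maps, and Cayley's formula. -/

section Forests

variable {V : Type*} [Fintype V] [DecidableEq V]

open Classical in
/-- The forests on `V` with root set `S`, given by their parent maps, extended by the identity
on `S`. -/
noncomputable def forests (S : Finset V) : Finset (V → V) :=
  Finset.univ.filter fun g => (∀ x ∈ S, g x = x) ∧ ∀ x, ∃ m, g^[m] x ∈ S

theorem mem_forests {S : Finset V} {g : V → V} :
    g ∈ forests S ↔ (∀ x ∈ S, g x = x) ∧ ∀ x, ∃ m, g^[m] x ∈ S := by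
  simp [forests]

/-- Turn the vertices of `A` into roots. -/
def freeze (g : V → V) (A : Finset V) : V → V := fun x => if x ∈ A then x else g x

theorem freeze_of_mem {g : V → V} {A : Finset V} {x : V} (h : x ∈ A) : freeze g A x = x := by
  simp [freeze, h]

theorem freeze_of_notMem {g : V → V} {A : Finset V} {x : V} (h : x ∉ A) :
    freeze g A x = g x := by
  simp [freeze, h]

theorem iterate_congr_off {f f' : V → V} {A : Finset V} (h : ∀ x, x ∉ A → f' x = f x) {w : V}
    {d : ℕ} (hw : ∀ i < d, f^[i] w ∉ A) : f'^[d] w = f^[d] w := by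
  induction d with
  | zero => rfl
  | succ d ih =>
    rw [Function.iterate_succ_apply', Function.iterate_succ_apply',
      ih fun i hi => hw i (by omega), h _ (hw d (by omega))]

theorem iterate_freeze {g : V → V} {A : Finset V} {w : V} {d : ℕ}
    (hw : ∀ i < d, g^[i] w ∉ A) : (freeze g A)^[d] w = g^[d] w :=
  iterate_congr_off (fun _ hx => freeze_of_notMem hx) hw

theorem exists_first_hit {g : V → V} {A : Finset V} {w : V} {m : ℕ} (h : g^[m] w ∈ A) :
    ∃ k ≤ m, g^[k] w ∈ A ∧ ∀ i < k, g^[i] w ∉ A := by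
  classical
  have hex : ∃ k, g^[k] w ∈ A := ⟨m, h⟩
  exact ⟨Nat.find hex, Nat.find_min' hex h, Nat.find_spec hex, fun i hi => Nat.find_min hex hi⟩

theorem iterate_stay {S : Finset V} {g : V → V} (hg : g ∈ forests S) {x : V} {m : ℕ}
    (h : g^[m] x ∈ S) (k : ℕ) : g^[m + k] x = g^[m] x := by
  induction k with
  | zero => rfl
  | succ k ih =>
    rw [← add_assoc, Function.iterate_succ_apply', ih, (mem_forests.1 hg).1 _ h]

/-- A cycle through x, run until after the entrance into S, would put x in S. -/
theorem iterate_ne_self {S : Finset V} {g : V → V} (hg : g ∈ forests S) {x : V} (hx : x ∉ S)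
    (j : ℕ) : g^[j + 1] x ≠ x := by
  intro h
  obtain ⟨m, hm⟩ := (mem_forests.1 hg).2 x
  have h1 : g^[(j + 1) * m] x = x := by
    rw [Function.iterate_mul]
    exact Function.iterate_fixed h m
  have h2 := iterate_stay hg hm (j * m)
  rw [show m + j * m = (j + 1) * m by ring, h1] at h2
  exact hx (h2 ▸ hm)

theorem freeze_mem_forests {S A : Finset V} {g : V → V} (hg : g ∈ forests S) (hA : S ⊆ A) :
    freeze g A ∈ forests A := by
  refine mem_forests.2 ⟨fun x hx => freeze_of_mem hx, fun x => ?_⟩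
  obtain ⟨m, hm⟩ := (mem_forests.1 hg).2 x
  obtain ⟨k, -, hk, hk'⟩ := exists_first_hit (hA hm)
  exact ⟨k, by rwa [iterate_freeze hk']⟩

theorem freeze_insert {S : Finset V} {g : V → V} (hg : g ∈ forests S) (y : V) :
    freeze g (insert y S) = Function.update g y y := by
  funext x
  by_cases hx : x = y
  · subst hx; simp [freeze]
  · by_cases hS : x ∈ S
    · simp [freeze, hx, hS, (mem_forests.1 hg).1 x hS]
    · simp [freeze, hx, hS]

theorem update_mem_forests {S : Finset V} {y : V} (hy : y ∉ S) {g : V → V}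
    (hg : g ∈ forests (insert y S)) {p : V} (hp : ∀ m, g^[m] p ≠ y) :
    Function.update g y p ∈ forests S := by
  have hag : ∀ x, x ∉ ({y} : Finset V) → Function.update g y p x = g x := fun x hx => by
    simp at hx; simp [hx]
  refine mem_forests.2 ⟨fun x hx => ?_, fun x => ?_⟩
  · rw [hag x (by simp; rintro rfl; exact hy hx)]
    exact (mem_forests.1 hg).1 x (Finset.mem_insert_of_mem hx)
  have hpS : ∃ m, (Function.update g y p)^[m] p ∈ S := by
    obtain ⟨m, hm⟩ := (mem_forests.1 hg).2 p
    refine ⟨m, ?_⟩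
    rw [iterate_congr_off hag fun i _ => by simpa using hp i]
    exact (Finset.mem_insert.1 hm).resolve_left (hp m)
  obtain ⟨m, hm⟩ := (mem_forests.1 hg).2 x
  obtain ⟨k, -, hk, hk'⟩ := exists_first_hit hm
  have hkx : (Function.update g y p)^[k] x = g^[k] x :=
    iterate_congr_off hag fun i hi => by
      have := hk' i hi
      simp at this
      simpa using this.1
  rcases Finset.mem_insert.1 hk with h | h
  · obtain ⟨m', hm'⟩ := hpS
    refine ⟨m' + 1 + k, ?_⟩
    rw [Function.iterate_add_apply, hkx, h, Function.iterate_succ_apply, Function.update_self]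
    exact hm'
  · exact ⟨k, hkx ▸ h⟩

theorem parent_not_descends {S : Finset V} {y : V} (hy : y ∉ S) {g : V → V}
    (hg : g ∈ forests S) (m : ℕ) : (Function.update g y y)^[m] (g y) ≠ y := by
  intro h
  obtain ⟨k, -, hk, hk'⟩ := exists_first_hit (A := {y}) (by simpa using h)
  have hag : ∀ x, x ∉ ({y} : Finset V) → g x = Function.update g y y x := fun x hx => by
    simp at hx; simp [hx]
  rw [← iterate_congr_off hag hk', Finset.mem_singleton, ← Function.iterate_succ_apply] at hk
  exact iterate_ne_self hg hy k hk

-- Cutting y from its parent p makes y a root; conversely y may be attached to any p outside its own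
-- tree.
open Classical in
theorem card_forests_eq_sum {S : Finset V} {y : V} (hy : y ∉ S) :
    (forests S).card = ∑ g ∈ forests (insert y S),
      (Finset.univ.filter fun p => ∀ m, g^[m] p ≠ y).card := by
  rw [← Finset.card_sigma]
  refine Finset.card_bij' (fun g _ => ⟨freeze g (insert y S), g y⟩)
    (fun q _ => Function.update q.1 y q.2) ?_ ?_ ?_ ?_
  · intro g hg
    simp only [Finset.mem_sigma, Finset.mem_filter, Finset.mem_univ, true_and]
    refine ⟨freeze_mem_forests hg (Finset.subset_insert _ _), fun m => ?_⟩
    rw [freeze_insert hg]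
    exact parent_not_descends hy hg m
  · rintro ⟨g, p⟩ hq
    simp only [Finset.mem_sigma, Finset.mem_filter, Finset.mem_univ, true_and] at hq
    exact update_mem_forests hy hq.1 hq.2
  · intro g hg
    simp [freeze_insert hg]
  · rintro ⟨g, p⟩ hq
    simp only [Finset.mem_sigma, Finset.mem_filter, Finset.mem_univ, true_and] at hq
    rw [freeze_insert (update_mem_forests hy hq.1 hq.2)]
    simp [(mem_forests.1 hq.1).1 y (Finset.mem_insert_self _ _)]

-- Conjugation by the transposition of y and z exchanges their trees.
open Classical in
theorem sum_descends_swap {S : Finset V} {y z : V} (hy : y ∈ S) (hz : z ∈ S) :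
    ∑ g ∈ forests S, (Finset.univ.filter fun p => ∃ m, g^[m] p = y).card =
      ∑ g ∈ forests S, (Finset.univ.filter fun p => ∃ m, g^[m] p = z).card := by
  have hσS : ∀ x, Equiv.swap y z x ∈ S ↔ x ∈ S := fun x => by
    by_cases h1 : x = y
    · subst h1; simp [hy, hz]
    by_cases h2 : x = z
    · subst h2; simp [hy, hz]
    rw [Equiv.swap_apply_of_ne_of_ne h1 h2]
  have hit : ∀ (g : V → V) (m : ℕ) (x : V),
      (fun x => Equiv.swap y z (g (Equiv.swap y z x)))^[m] x =
        Equiv.swap y z (g^[m] (Equiv.swap y z x)) := fun g m x => by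
    induction m with
    | zero => simp
    | succ m ih => rw [Function.iterate_succ_apply', ih, Function.iterate_succ_apply']; simp
  have hmem : ∀ g ∈ forests S, (fun x => Equiv.swap y z (g (Equiv.swap y z x))) ∈ forests S := by
    intro g hg
    refine mem_forests.2 ⟨fun x hx => ?_, fun x => ?_⟩
    · simp [(mem_forests.1 hg).1 _ ((hσS x).2 hx)]
    · obtain ⟨m, hm⟩ := (mem_forests.1 hg).2 (Equiv.swap y z x)
      exact ⟨m, by rw [hit, hσS]; exact hm⟩
  refine Finset.sum_bij' (fun g _ => fun x => Equiv.swap y z (g (Equiv.swap y z x)))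
    (fun g _ => fun x => Equiv.swap y z (g (Equiv.swap y z x))) hmem hmem
    (fun g _ => by simp) (fun g _ => by simp) ?_
  intro g _
  refine Finset.card_bij' (fun p _ => Equiv.swap y z p) (fun p _ => Equiv.swap y z p) ?_ ?_
    (fun p _ => by simp) (fun p _ => by simp)
  · intro p hp
    simp only [Finset.mem_filter, Finset.mem_univ, true_and] at hp ⊢
    obtain ⟨m, hm⟩ := hp
    exact ⟨m, by rw [hit]; simp [hm]⟩
  · intro p hp
    simp only [Finset.mem_filter, Finset.mem_univ, true_and] at hp ⊢
    obtain ⟨m, hm⟩ := hp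
    refine ⟨m, ?_⟩
    rw [hit] at hm
    exact (Equiv.swap y z).injective (hm.trans (Equiv.swap_apply_left y z).symm)

-- By symmetry all roots have the same mean tree size, and the trees partition V.
open Classical in
theorem card_mul_sum_descends {S : Finset V} {y : V} (hy : y ∈ S) :
    S.card * ∑ g ∈ forests S, (Finset.univ.filter fun p => ∃ m, g^[m] p = y).card =
      (forests S).card * Fintype.card V := by
  rw [← smul_eq_mul, ← Finset.sum_const,
    Finset.sum_congr rfl fun z hz => sum_descends_swap hy hz, Finset.sum_comm,
    ← smul_eq_mul, ← Finset.sum_const]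
  refine Finset.sum_congr rfl fun g hg => ?_
  rw [← Finset.card_biUnion]
  · rw [← Finset.card_univ]
    congr 1
    ext p
    obtain ⟨m, hm⟩ := (mem_forests.1 hg).2 p
    simp only [Finset.mem_biUnion, Finset.mem_filter, Finset.mem_univ, true_and, iff_true]
    exact ⟨_, hm, m, rfl⟩
  · intro a ha b hb hab
    rw [Function.onFun, Finset.disjoint_left]
    intro p hp hp'
    simp only [Finset.mem_filter, Finset.mem_univ, true_and] at hp hp'
    obtain ⟨m, rfl⟩ := hp
    obtain ⟨m', rfl⟩ := hp'
    apply hab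
    rw [← iterate_stay hg ha m', ← iterate_stay hg hb m, add_comm]

/-- **Cayley's formula** for forests with a given set of roots. -/
theorem card_forests [Nonempty V] (S : Finset V) :
    ((forests S).card : ℝ) =
      S.card * (Fintype.card V : ℝ) ^ Fintype.card V / (Fintype.card V : ℝ) ^ (S.card + 1) := by
  classical
  have hn : (Fintype.card V : ℝ) ≠ 0 := by
    exact_mod_cast Fintype.card_ne_zero
  induction h : Sᶜ.card generalizing S with
  | zero =>
    have hS : S = Finset.univ := by
      rwa [Finset.card_eq_zero, Finset.compl_eq_empty_iff] at h
    have : forests (Finset.univ : Finset V) = {id} := by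
      ext g
      simp only [mem_forests, Finset.mem_univ, true_imp_iff, Finset.mem_singleton]
      exact ⟨fun h => funext h.1, fun h => by subst h; simp⟩
    -- With every vertex a root the exponent in k n^(n-k-1) is -1, which is why the formula is
    -- written as a quotient.
    rw [hS, this, Finset.card_univ, pow_succ]
    field_simp
    simp
  | succ k ih =>
    obtain ⟨y, hy⟩ : Sᶜ.Nonempty := Finset.card_pos.1 (by omega)
    have hyS : y ∉ S := by simpa using hy
    have hc : (insert y S).card = S.card + 1 := Finset.card_insert_of_notMem hyS
    have ih' := ih (insert y S) (by
      rw [Finset.compl_insert, Finset.card_erase_of_mem hy, h]; rfl)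
    -- On average y can be attached to n - n/(|S|+1) vertices, which gives the recursion in |S|.
    have h1 := card_forests_eq_sum hyS
    have h2 := card_mul_sum_descends (Finset.mem_insert_self y S)
    have h3 : ∀ g : V → V, ((Finset.univ.filter fun p => ∀ m, g^[m] p ≠ y).card : ℝ) =
        Fintype.card V - ((Finset.univ.filter fun p => ∃ m, g^[m] p = y).card : ℝ) := by
      intro g
      have h4 := Finset.card_filter_add_card_filter_not (s := (Finset.univ : Finset V))
        (fun p => ∃ m, g^[m] p = y)
      simp only [not_exists] at h4
      rw [eq_sub_iff_add_eq, add_comm, ← Finset.card_univ]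
      exact_mod_cast h4
    have h1' : ((forests S).card : ℝ) = (forests (insert y S)).card * Fintype.card V -
        ∑ g ∈ forests (insert y S),
          ((Finset.univ.filter fun p => ∃ m, g^[m] p = y).card : ℝ) := by
      rw [h1]
      push_cast
      rw [Finset.sum_congr rfl fun g _ => h3 g, Finset.sum_sub_distrib]
      simp
    have h2' : ((S.card : ℝ) + 1) * ∑ g ∈ forests (insert y S),
          ((Finset.univ.filter fun p => ∃ m, g^[m] p = y).card : ℝ) =
        (forests (insert y S)).card * Fintype.card V := by
      rw [hc] at h2
      exact_mod_cast h2
    have hk : ((S.card : ℝ) + 1) ≠ 0 := by positivity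
    rw [← mul_right_inj' hk, h1', mul_sub, h2', ih', hc, pow_succ _ (S.card + 1)]
    push_cast
    field_simp
    ring

end Forests

/-! ### Cutting a trail: a vertex at height d becomes d additional roots. -/

section Levels

variable {V : Type*} [Fintype V] [DecidableEq V]

/-- The vertices at height `d` above the root `s`. -/
def level (g : V → V) (S : Finset V) (s : V) (d : ℕ) : Finset V :=
  Finset.univ.filter fun w => g^[d] w = s ∧ ∀ i < d, g^[i] w ∉ S

theorem mem_level {g : V → V} {S : Finset V} {s : V} {d : ℕ} {w : V} :
    w ∈ level g S s d ↔ g^[d] w = s ∧ ∀ i < d, g^[i] w ∉ S := by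
  simp [level]

/-- The first `d` vertices on the way from `w` to its root. -/
def trail (g : V → V) (w : V) (d : ℕ) : Finset V := (Finset.range d).image fun i => g^[i] w

theorem mem_trail {g : V → V} {w x : V} {d : ℕ} : x ∈ trail g w d ↔ ∃ i < d, g^[i] w = x := by
  simp [trail]

theorem trail_injOn {g : V → V} {S : Finset V} {s : V} (hs : s ∈ S) {d : ℕ} {w : V}
    (hw : w ∈ level g S s d) : Set.InjOn (fun i => g^[i] w) (Finset.range d) := by
  have key : ∀ i j, i < j → j < d → g^[i] w ≠ g^[j] w := by
    intro i j hij hj h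
    obtain ⟨h1, h2⟩ := mem_level.1 hw
    have h3 : g^[d - j + i] w = s := by
      rw [Function.iterate_add_apply, h, ← Function.iterate_add_apply, ← h1]
      congr 2; omega
    exact h2 (d - j + i) (by omega) (h3 ▸ hs)
  intro i hi j hj hij
  simp only [Finset.coe_range, Set.mem_Iio] at hi hj
  rcases lt_trichotomy i j with h | h | h
  · exact absurd hij (key i j h hj)
  · exact h
  · exact absurd hij.symm (key j i h hi)

theorem card_trail {g : V → V} {S : Finset V} {s : V} (hs : s ∈ S) {d : ℕ} {w : V}
    (hw : w ∈ level g S s d) : (trail g w d).card = d := by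
  rw [trail, Finset.card_image_of_injOn (trail_injOn hs hw), Finset.card_range]

theorem trail_disjoint {g : V → V} {S : Finset V} {s : V} {d : ℕ} {w : V}
    (hw : w ∈ level g S s d) : Disjoint S (trail g w d) := by
  rw [Finset.disjoint_right]
  intro x hx
  obtain ⟨i, hi, rfl⟩ := mem_trail.1 hx
  exact (mem_level.1 hw).2 i hi

theorem freeze_freeze {g : V → V} {A B : Finset V} (h : A ⊆ B) :
    freeze (freeze g A) B = freeze g B := by
  funext x
  by_cases hx : x ∈ B
  · simp [freeze, hx]
  · have : x ∉ A := fun h' => hx (h h')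
    simp [freeze, hx, this]

/-- A trail that enters s through its child x is a trail to x, one step shorter, once x is a root.
-/
theorem level_filter_eq {S : Finset V} {s x : V} (hx : x ∉ S) {g : V → V}
    (hg : g ∈ forests S) (hgx : g x = s) (d : ℕ) :
    ((level g S s (d + 1)).filter fun w => g^[d] w = x) =
      level (freeze g (insert x S)) (insert x S) x d := by
  ext w
  simp only [Finset.mem_filter, mem_level]
  constructor
  · rintro ⟨⟨-, h2⟩, h3⟩
    have h4 : ∀ i < d, g^[i] w ∉ insert x S := by
      intro i hi h
      rcases Finset.mem_insert.1 h with h | h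
      · refine iterate_ne_self hg hx (d - i - 1) ?_
        conv_lhs => rw [← h]
        rw [← Function.iterate_add_apply, ← h3]
        congr 2; omega
      · exact h2 i (by omega) h
    refine ⟨by rw [iterate_freeze h4, h3], fun i hi => ?_⟩
    rw [iterate_freeze fun j hj => h4 j (by omega)]
    exact h4 i hi
  · rintro ⟨h1, h2⟩
    have hag : ∀ y, y ∉ insert x S → g y = freeze g (insert x S) y := fun y hy =>
      (freeze_of_notMem hy).symm
    have hd : g^[d] w = x := by rw [iterate_congr_off hag h2, h1]
    refine ⟨⟨by rw [Function.iterate_succ_apply', hd, hgx], fun i hi => ?_⟩, hd⟩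
    rcases Nat.lt_succ_iff_lt_or_eq.1 hi with hi | rfl
    · rw [iterate_congr_off hag fun j hj => h2 j (by omega)]
      exact fun h => h2 i hi (Finset.mem_insert_of_mem h)
    · rwa [hd]

theorem union_trail_succ {S : Finset V} {s x : V} {g : V → V} {d : ℕ} {w : V}
    (hw : w ∈ (level g S s (d + 1)).filter fun w => g^[d] w = x)
    (hw' : w ∈ level (freeze g (insert x S)) (insert x S) x d) :
    S ∪ trail g w (d + 1) = insert x S ∪ trail (freeze g (insert x S)) w d := by
  have hag : ∀ y, y ∉ insert x S → g y = freeze g (insert x S) y := fun y hy =>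
      (freeze_of_notMem hy).symm
  have hit : ∀ i < d, g^[i] w = (freeze g (insert x S))^[i] w := fun i hi =>
    iterate_congr_off hag fun j hj => (mem_level.1 hw').2 j (by omega)
  have h3 := (Finset.mem_filter.1 hw).2
  ext y
  simp only [Finset.mem_union, Finset.mem_insert, mem_trail]
  constructor
  · rintro (h | ⟨i, hi, rfl⟩)
    · exact Or.inl (Or.inr h)
    · rcases Nat.lt_succ_iff_lt_or_eq.1 hi with hi | rfl
      · exact Or.inr ⟨i, hi, (hit i hi).symm⟩
      · exact Or.inl (Or.inl h3)
  · rintro ((h | h) | ⟨i, hi, rfl⟩)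
    · exact Or.inr ⟨d, by omega, by rw [h3, h]⟩
    · exact Or.inl h
    · exact Or.inr ⟨i, by omega, hit i hi⟩

/-- Sum over the forests rooted at `S` and the vertices at height `d` above `s` of a function of the
forest in which the trail of the vertex is turned into roots. -/
noncomputable def sumLevel (d : ℕ) (S : Finset V) (s : V) (Φ : Finset V → (V → V) → ℝ) : ℝ :=
  ∑ g ∈ forests S, ∑ w ∈ level g S s d, Φ (S ∪ trail g w d) (freeze g (S ∪ trail g w d))

theorem sumLevel_zero {S : Finset V} {s : V} (Φ : Finset V → (V → V) → ℝ) :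
    sumLevel 0 S s Φ = ∑ g ∈ forests S, Φ S g := by
  refine Finset.sum_congr rfl fun g hg => ?_
  have h1 : level g S s 0 = {s} := by ext w; simp [mem_level]
  have h2 : freeze g S = g := by
    funext x
    by_cases hx : x ∈ S
    · rw [freeze_of_mem hx, (mem_forests.1 hg).1 x hx]
    · exact freeze_of_notMem hx
  simp [h1, trail, h2]

/-- Classify w by the child x of s through which its trail passes. Deleting the edge from x to s is
a bijection from the forests with `g x = s` onto all the forests rooted at `insert x S`. -/
theorem sumLevel_succ {S : Finset V} {s : V} (hs : s ∈ S) (d : ℕ) (Φ : Finset V → (V → V) → ℝ) :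
    sumLevel (d + 1) S s Φ = ∑ x ∈ Sᶜ, sumLevel d (insert x S) x Φ := by
  unfold sumLevel
  have h1 : ∀ g ∈ forests S, ∑ w ∈ level g S s (d + 1),
      Φ (S ∪ trail g w (d + 1)) (freeze g (S ∪ trail g w (d + 1))) =
      ∑ x ∈ Sᶜ, ∑ w ∈ (level g S s (d + 1)).filter (fun w => g^[d] w = x),
        Φ (S ∪ trail g w (d + 1)) (freeze g (S ∪ trail g w (d + 1))) := fun g _ =>
    (Finset.sum_fiberwise_of_maps_to (fun w hw => by
      simpa using (mem_level.1 hw).2 d (by omega)) _).symm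
  rw [Finset.sum_congr rfl h1, Finset.sum_comm]
  refine Finset.sum_congr rfl fun x hx => ?_
  have hx : x ∉ S := by simpa using hx
  rw [← Finset.sum_filter_of_ne (p := fun g => g x = s)]
  · refine Finset.sum_bij' (fun g _ => freeze g (insert x S)) (fun g _ => Function.update g x s)
      ?_ ?_ ?_ ?_ ?_
    · intro g hg
      exact freeze_mem_forests (Finset.mem_filter.1 hg).1 (Finset.subset_insert _ _)
    · intro g hg
      refine Finset.mem_filter.2 ⟨update_mem_forests hx hg fun m h => ?_, by simp⟩
      rw [Function.iterate_fixed ((mem_forests.1 hg).1 s (Finset.mem_insert_of_mem hs))] at h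
      exact hx (h ▸ hs)
    · intro g hg
      obtain ⟨hg, hgx⟩ := Finset.mem_filter.1 hg
      simp [freeze_insert hg, ← hgx]
    · intro g hg
      have : Function.update g x s ∈ forests S := by
        refine update_mem_forests hx hg fun m h => ?_
        rw [Function.iterate_fixed ((mem_forests.1 hg).1 s (Finset.mem_insert_of_mem hs))] at h
        exact hx (h ▸ hs)
      rw [freeze_insert this]
      simp [(mem_forests.1 hg).1 x (Finset.mem_insert_self _ _)]
    · intro g hg
      obtain ⟨hg, hgx⟩ := Finset.mem_filter.1 hg
      refine Finset.sum_congr (level_filter_eq hx hg hgx d) fun w hw => ?_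
      rw [union_trail_succ (level_filter_eq hx hg hgx d ▸ hw) hw,
        freeze_freeze Finset.subset_union_left]
  · intro g hg hne
    obtain ⟨w, hw, -⟩ := Finset.exists_ne_zero_of_sum_ne_zero hne
    obtain ⟨hw, hwx⟩ := Finset.mem_filter.1 hw
    rw [← hwx, ← Function.iterate_succ_apply' g]
    exact (mem_level.1 hw).1

/-- The falling factorial counts the possible trails, and each leaves an unrestricted forest with d
more roots. -/
theorem sumLevel_le {S : Finset V} {s : V} (hs : s ∈ S) (d : ℕ) {Φ : Finset V → (V → V) → ℝ}
    {C : ℝ} (hC : ∀ A, S ⊆ A → A.card = S.card + d → ∑ g ∈ forests A, Φ A g ≤ C) :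
    sumLevel d S s Φ ≤ ((Fintype.card V - S.card).descFactorial d : ℝ) * C := by
  induction d generalizing S s with
  | zero => rw [sumLevel_zero]; simpa using hC S subset_rfl rfl
  | succ d ih =>
    rw [sumLevel_succ hs]
    have h : ∀ x ∈ Sᶜ, sumLevel d (insert x S) x Φ ≤
        ((Fintype.card V - S.card - 1).descFactorial d : ℝ) * C := by
      intro x hx
      have hx : x ∉ S := by simpa using hx
      have := ih (S := insert x S) (Finset.mem_insert_self _ _) fun A hA hc =>
        hC A ((Finset.subset_insert _ _).trans hA) (by
          rw [hc, Finset.card_insert_of_notMem hx]; omega)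
      rwa [Finset.card_insert_of_notMem hx, ← Nat.sub_sub] at this
    refine (Finset.sum_le_sum h).trans (le_of_eq ?_)
    rw [Finset.sum_const, nsmul_eq_mul, ← mul_assoc, Finset.card_compl]
    congr 1
    rcases Nat.eq_zero_or_eq_succ_pred (Fintype.card V - S.card) with h0 | h0
    · simp [h0]
    · rw [h0, Nat.succ_sub_one, Nat.succ_eq_add_one, Nat.succ_descFactorial_succ]
      push_cast
      ring

theorem sumLevel_eq {S : Finset V} {s : V} (hs : s ∈ S) (d : ℕ) {Φ : Finset V → (V → V) → ℝ}
    {C : ℝ} (hC : ∀ A, S ⊆ A → A.card = S.card + d → ∑ g ∈ forests A, Φ A g = C) :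
    sumLevel d S s Φ = ((Fintype.card V - S.card).descFactorial d : ℝ) * C := by
  refine le_antisymm (sumLevel_le hs d fun A hA hc => (hC A hA hc).le) ?_
  have h := sumLevel_le hs d (Φ := fun A g => -Φ A g) (C := -C) fun A hA hc => by
    rw [Finset.sum_neg_distrib, hC A hA hc]
  have h2 : sumLevel d S s (fun A g => -Φ A g) = -sumLevel d S s Φ := by
    simp [sumLevel]
  rw [h2] at h
  linarith

end Levels

/-! ### First and second moments of the level sizes. -/

section Counting

variable {V : Type*} [Fintype V] [DecidableEq V] [Nonempty V]

/-- The number of forests with `k` given roots on `n` vertices. -/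
noncomputable def forestCount (n k : ℕ) : ℝ := k * (n : ℝ) ^ n / (n : ℝ) ^ (k + 1)

theorem forestCount_nonneg (n k : ℕ) : 0 ≤ forestCount n k := by
  unfold forestCount; positivity

theorem card_forests_eq (S : Finset V) :
    ((forests S).card : ℝ) = forestCount (Fintype.card V) S.card := card_forests S

theorem pow_mul_forestCount {n : ℕ} (hn : 0 < n) (c h : ℕ) :
    (n : ℝ) ^ h * forestCount n (c + h) = (c + h) * ((n : ℝ) ^ n / (n : ℝ) ^ (c + 1)) := by
  have : (n : ℝ) ≠ 0 := by positivity
  unfold forestCount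
  rw [show c + h + 1 = h + (c + 1) by ring, pow_add]
  push_cast
  field_simp

theorem descFactorial_sub_le (n c h : ℕ) : ((n - c).descFactorial h : ℝ) ≤ (n : ℝ) ^ h := by
  exact_mod_cast (Nat.descFactorial_le_pow _ _).trans (Nat.pow_le_pow_left (Nat.sub_le _ _) _)

theorem le_descFactorial_sub {n c h : ℕ} (hch : c + h ≤ n) :
    (n : ℝ) ^ h * (1 - h * (c + h) / n) ≤ ((n - c).descFactorial h : ℝ) := by
  rcases Nat.eq_zero_or_pos n with rfl | hn
  · obtain ⟨rfl, rfl⟩ : c = 0 ∧ h = 0 := by omega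
    simp
  have hn' : (0 : ℝ) < n := by exact_mod_cast hn
  have h1 : ((n : ℝ) - c - h) ^ h ≤ ((n - c).descFactorial h : ℝ) := by
    have h2 : (n - c - h) ^ h ≤ (n - c).descFactorial h :=
      (Nat.pow_le_pow_left (by omega) h).trans (Nat.pow_sub_le_descFactorial (n - c) h)
    have h3 : ((n - c - h : ℕ) : ℝ) = (n : ℝ) - c - h := by
      rw [Nat.cast_sub (by omega), Nat.cast_sub (by omega)]
    rw [← h3]
    exact_mod_cast h2
  refine le_trans ?_ h1
  -- This is what makes Bernoulli's inequality applicable to (1 - (c+h)/n)^h.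
  have hle : ((c : ℝ) + h) / n ≤ 1 := by
    rw [div_le_one hn']
    exact_mod_cast hch
  have h4 := one_add_mul_le_pow (a := -(((c : ℝ) + h) / n)) (by linarith) h
  have h5 : (n : ℝ) - c - h = n * (1 + -(((c : ℝ) + h) / n)) := by field_simp; ring
  rw [h5, mul_pow]
  gcongr
  refine le_trans (le_of_eq ?_) h4
  ring

theorem sum_card_level {S : Finset V} {s : V} (hs : s ∈ S) (h : ℕ) :
    ∑ g ∈ forests S, ((level g S s h).card : ℝ) =
      ((Fintype.card V - S.card).descFactorial h : ℝ) *
        forestCount (Fintype.card V) (S.card + h) := by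
  have h1 := sumLevel_eq hs h (Φ := fun _ _ => (1 : ℝ))
    (C := forestCount (Fintype.card V) (S.card + h)) fun A _ hc => by
      simp [card_forests_eq, hc]
  rw [← h1]
  simp [sumLevel]

theorem sum_card_level_le {S : Finset V} {s : V} (hs : s ∈ S) (h : ℕ) :
    ∑ g ∈ forests S, ((level g S s h).card : ℝ) ≤
      (S.card + h) * ((Fintype.card V : ℝ) ^ Fintype.card V /
        (Fintype.card V : ℝ) ^ (S.card + 1)) := by
  rw [sum_card_level hs, ← pow_mul_forestCount Fintype.card_pos]
  exact mul_le_mul_of_nonneg_right (descFactorial_sub_le _ _ _) (forestCount_nonneg _ _)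

theorem le_sum_card_level {S : Finset V} {s : V} (hs : s ∈ S) {h : ℕ}
    (hch : S.card + h ≤ Fintype.card V) :
    (1 - h * (S.card + h) / Fintype.card V) * ((S.card + h) *
      ((Fintype.card V : ℝ) ^ Fintype.card V / (Fintype.card V : ℝ) ^ (S.card + 1))) ≤
      ∑ g ∈ forests S, ((level g S s h).card : ℝ) := by
  rw [sum_card_level hs, ← pow_mul_forestCount Fintype.card_pos, ← mul_assoc]
  refine mul_le_mul_of_nonneg_right ?_ (forestCount_nonneg _ _)
  rw [mul_comm]
  exact le_descFactorial_sub hch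

/-- Two vertices whose trails meet have the same root. -/
theorem root_unique {g : V → V} {S : Finset V} (hg : g ∈ forests S) {s s' w w' : V} (hs : s ∈ S)
    (hs' : s' ∈ S) {d d' i j : ℕ} (hw : w ∈ level g S s d) (hw' : w' ∈ level g S s' d')
    (hi : i ≤ d) (hj : j ≤ d') (hij : g^[i] w = g^[j] w') : s = s' ∧ d - i = d' - j := by
  have h1 : g^[d - i] (g^[i] w) = s := by
    rw [← Function.iterate_add_apply, ← (mem_level.1 hw).1]; congr 2; omega
  have h2 : g^[d' - j] (g^[j] w') = s' := by
    rw [← Function.iterate_add_apply, ← (mem_level.1 hw').1]; congr 2; omega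
  have key : ∀ {a b : ℕ} {x y s s' : V}, s ∈ S → s' ∈ S → x = y → g^[a] x = s → g^[b] y = s' →
      s = s' := by
    rintro a b x y s s' hs hs' rfl h1 h2
    have h3 := iterate_stay hg (h1 ▸ hs) b
    have h4 := iterate_stay hg (h2 ▸ hs') a
    rw [← h1, ← h2, ← h3, ← h4, add_comm]
  refine ⟨key hs hs' hij h1 h2, ?_⟩
  rcases lt_trichotomy (d - i) (d' - j) with h | h | h
  · exfalso
    refine (mem_level.1 hw').2 (d - i + j) (by omega) ?_
    rw [Function.iterate_add_apply, ← hij, h1]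
    exact hs
  · exact h
  · exfalso
    refine (mem_level.1 hw).2 (d' - j + i) (by omega) ?_
    rw [Function.iterate_add_apply, hij, h2]
    exact hs'

/-- The trail of w stays in the tree of s, so freezing it leaves the tree of s' intact. -/
theorem level_subset_freeze {g : V → V} {S : Finset V} (hg : g ∈ forests S) {s s' w : V}
    (hs : s ∈ S) (hs' : s' ∈ S) (hne : s ≠ s') {h h' : ℕ} (hw : w ∈ level g S s h) :
    level g S s' h' ⊆ level (freeze g (S ∪ trail g w h)) (S ∪ trail g w h) s' h' := by
  intro w' hw'
  have h1 : ∀ i < h', g^[i] w' ∉ S ∪ trail g w h := by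
    intro i hi hmem
    rcases Finset.mem_union.1 hmem with hm | hm
    · exact (mem_level.1 hw').2 i hi hm
    · obtain ⟨j, hj, hj'⟩ := mem_trail.1 hm
      exact hne (root_unique hg hs hs' hw hw' hj.le hi.le hj').1
  refine mem_level.2 ⟨by rw [iterate_freeze h1, (mem_level.1 hw').1], fun i hi => ?_⟩
  rw [iterate_freeze fun j hj => h1 j (by omega)]
  exact h1 i hi

/-- Cut the trail of the first vertex, then apply the first moment in the forest with h more roots.
-/
theorem sum_card_level_mul_le {S : Finset V} {s s' : V} (hs : s ∈ S) (hs' : s' ∈ S) (hne : s ≠ s')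
    (h h' : ℕ) :
    ∑ g ∈ forests S, ((level g S s h).card : ℝ) * ((level g S s' h').card : ℝ) ≤
      (S.card + h + h') * ((Fintype.card V : ℝ) ^ Fintype.card V /
        (Fintype.card V : ℝ) ^ (S.card + 1)) := by
  have hn : (Fintype.card V : ℝ) ≠ 0 := by exact_mod_cast Fintype.card_ne_zero
  have h1 : ∑ g ∈ forests S, ((level g S s h).card : ℝ) * ((level g S s' h').card : ℝ) ≤
      sumLevel h S s fun A g => ((level g A s' h').card : ℝ) := by
    refine Finset.sum_le_sum fun g hg => ?_
    rw [← nsmul_eq_mul, ← Finset.sum_const]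
    exact Finset.sum_le_sum fun w hw =>
      Nat.cast_le.2 (Finset.card_le_card (level_subset_freeze hg hs hs' hne hw))
  refine h1.trans ((sumLevel_le hs h (C := (S.card + h + h') *
    ((Fintype.card V : ℝ) ^ Fintype.card V / (Fintype.card V : ℝ) ^ (S.card + h + 1)))
    fun A hA hc => ?_).trans ?_)
  · refine (sum_card_level_le (hA hs') h').trans (le_of_eq ?_)
    rw [hc]; push_cast; ring
  · refine (mul_le_mul_of_nonneg_right (descFactorial_sub_le _ _ _)
      (by positivity)).trans (le_of_eq ?_)
    rw [show S.card + h + 1 = h + (S.card + 1) by ring, pow_add]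
    field_simp

/-- In the same tree, the way down from w' first meets the trail of w (or s) at some y, after j ≤ h'
steps. -/
theorem level_subset_biUnion {g : V → V} {S : Finset V} {s : V} (hs : s ∈ S) (w : V)
    (h h' : ℕ) :
    level g S s h' ⊆ (insert s ((S ∪ trail g w h) \ S)).biUnion fun y =>
      (Finset.range (h' + 1)).biUnion fun j =>
        level (freeze g (S ∪ trail g w h)) (S ∪ trail g w h) y j := by
  intro w' hw'
  have h0 : g^[h'] w' ∈ S ∪ trail g w h := by
    rw [(mem_level.1 hw').1]; exact Finset.mem_union_left _ hs
  obtain ⟨j, hj, hj1, hj2⟩ := exists_first_hit h0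
  simp only [Finset.mem_biUnion]
  refine ⟨g^[j] w', ?_, j, by simp; omega, mem_level.2 ⟨iterate_freeze hj2, fun i hi => ?_⟩⟩
  · by_cases hjS : g^[j] w' ∈ S
    · have : j = h' := by
        by_contra hne
        exact (mem_level.1 hw').2 j (by omega) hjS
      rw [this, (mem_level.1 hw').1]
      exact Finset.mem_insert_self _ _
    · exact Finset.mem_insert_of_mem (Finset.mem_sdiff.2 ⟨hj1, hjS⟩)
  · rw [iterate_freeze fun k hk => hj2 k (by omega)]
    exact hj2 i hi

/-- The factor (h+1)(h'+1) pays for the meeting point and its distance to the second vertex. This is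
crude, but the application keeps heights below a constant. -/
theorem sum_card_level_mul_self_le {S : Finset V} {s : V} (hs : s ∈ S) (h h' : ℕ) :
    ∑ g ∈ forests S, ((level g S s h).card : ℝ) * ((level g S s h').card : ℝ) ≤
      (h + 1) * (h' + 1) * ((S.card + h + h') * ((Fintype.card V : ℝ) ^ Fintype.card V /
        (Fintype.card V : ℝ) ^ (S.card + 1))) := by
  have hn : (Fintype.card V : ℝ) ≠ 0 := by exact_mod_cast Fintype.card_ne_zero
  have h1 : ∑ g ∈ forests S, ((level g S s h).card : ℝ) * ((level g S s h').card : ℝ) ≤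
      sumLevel h S s fun A g => ∑ y ∈ insert s (A \ S), ∑ j ∈ Finset.range (h' + 1),
        ((level g A y j).card : ℝ) := by
    refine Finset.sum_le_sum fun g _ => ?_
    rw [← nsmul_eq_mul, ← Finset.sum_const]
    refine Finset.sum_le_sum fun w _ => ?_
    refine (Nat.cast_le.2 (Finset.card_le_card (level_subset_biUnion hs w h h'))).trans ?_
    refine (Nat.cast_le.2 Finset.card_biUnion_le).trans ?_
    push_cast
    refine Finset.sum_le_sum fun y _ => ?_
    refine (Nat.cast_le.2 Finset.card_biUnion_le).trans ?_
    push_cast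
    rfl
  refine h1.trans ((sumLevel_le hs h (C := (h + 1) * (h' + 1) * ((S.card + h + h') *
    ((Fintype.card V : ℝ) ^ Fintype.card V / (Fintype.card V : ℝ) ^ (S.card + h + 1))))
    fun A hA hc => ?_).trans ?_)
  · rw [Finset.sum_comm]
    have h2 : ∀ y ∈ insert s (A \ S), ∑ g ∈ forests A, ∑ j ∈ Finset.range (h' + 1),
        ((level g A y j).card : ℝ) ≤ (h' + 1) * ((S.card + h + h') *
          ((Fintype.card V : ℝ) ^ Fintype.card V / (Fintype.card V : ℝ) ^ (S.card + h + 1))) := by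
      intro y hy
      have hyA : y ∈ A := by
        rcases Finset.mem_insert.1 hy with rfl | hy
        · exact hA hs
        · exact (Finset.mem_sdiff.1 hy).1
      rw [Finset.sum_comm]
      have h3 : ∀ j ∈ Finset.range (h' + 1), ∑ g ∈ forests A, ((level g A y j).card : ℝ) ≤
          (S.card + h + h') * ((Fintype.card V : ℝ) ^ Fintype.card V /
            (Fintype.card V : ℝ) ^ (S.card + h + 1)) := by
        intro j hj
        refine (sum_card_level_le hyA j).trans ?_
        rw [hc]
        have : (j : ℝ) ≤ h' := by
          exact_mod_cast Nat.lt_succ_iff.1 (Finset.mem_range.1 hj)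
        push_cast
        gcongr
      refine (Finset.sum_le_sum h3).trans (le_of_eq ?_)
      simp
    refine (Finset.sum_le_sum h2).trans ?_
    rw [Finset.sum_const, nsmul_eq_mul, mul_assoc]
    refine mul_le_mul_of_nonneg_right ?_ (by positivity)
    have : (insert s (A \ S)).card ≤ h + 1 := by
      refine (Finset.card_insert_le _ _).trans ?_
      rw [Finset.card_sdiff_of_subset hA]
      omega
    exact_mod_cast this
  · refine (mul_le_mul_of_nonneg_right (descFactorial_sub_le _ _ _)
      (by positivity)).trans (le_of_eq ?_)
    rw [show S.card + h + 1 = h + (S.card + 1) by ring, pow_add]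
    field_simp

end Counting

/-! ### Static criteria for fireproof and burnt edges. -/

section Static

variable {V : Type*} [Fintype V] (G : SimpleGraph V) (F B : Sym2 V → ℝ)

/-- `e'` shares a vertex with `e` and satisfies `p`. -/
def Linked (p : G.edgeSet → Prop) (e e' : G.edgeSet) : Prop :=
  p e' ∧ ∃ v : V, v ∈ (e : Sym2 V) ∧ v ∈ (e' : Sym2 V)

/-- Without running the dynamics: a fire would reach `e` if nothing else happened. -/
def Exposed (e : G.edgeSet) : Prop :=
  ∃ e₀ : G.edgeSet, B e₀ ≤ F e₀ ∧ Relation.ReflTransGen (Linked G fun e' => B e₀ ≤ F e') e₀ e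

variable {G F B}

/-- Invariant: an inflammable edge still has its fireproofing clock ahead. A fire at time s
therefore travels through edges with F ≥ s only, equality being possible because `step` lets fire
win ties. -/
theorem foldl_step_exposed (l : List ℝ) (hl : l.Pairwise (· < ·)) (σ : G.edgeSet → EdgeState)
    (hb : ∀ e, σ e = EdgeState.burnt → Exposed G F B e)
    (hi : ∀ e, σ e = EdgeState.inflammable → F e ∈ l) (e : G.edgeSet)
    (he : l.foldl (step G F B) σ e ≠ EdgeState.fireproof) : Exposed G F B e := by
  induction l generalizing σ with
  | nil =>
    simp only [List.foldl_nil] at he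
    cases h : σ e with
    | inflammable => simpa using hi e h
    | fireproof => exact absurd h he
    | burnt => exact hb e h
  | cons s l ih =>
    rw [List.pairwise_cons] at hl
    refine ih hl.2 (step G F B σ s) ?_ ?_ he
    · intro e he
      unfold step at he
      split_ifs at he with h1 h2 h3
      · obtain ⟨e₀, h4, h5, h6⟩ := h2
        have hle : ∀ e', σ e' = EdgeState.inflammable → B e₀ ≤ F e' := by
          intro e' he'
          rcases List.mem_cons.1 (hi e' he') with h | h
          · rw [h5, h]
          · rw [h5]; exact (hl.1 _ h).le
        exact ⟨e₀, hle _ h4, Relation.ReflTransGen.mono (fun a b hab => ⟨hle _ hab.1, hab.2⟩) _ _ h6⟩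
      · exact hb e he
    · intro e he
      unfold step at he
      split_ifs at he with h1 h2 h3
      · exact (List.mem_cons.1 (hi e h1)).resolve_left h3
      · exact absurd he h1

theorem exposed_of_not_fireproof {e : G.edgeSet}
    (he : terminalState G F B e ≠ EdgeState.fireproof) : Exposed G F B e := by
  refine foldl_step_exposed _ (Finset.sortedLT_sort _).pairwise _ (fun e h => by simp at h)
    (fun e _ => ?_) e he
  classical
  rw [Finset.mem_sort, ringTimes, Finset.mem_union]
  exact Or.inl (Finset.mem_image_of_mem _ (Finset.mem_univ _))

/-- The cluster of e₀ formed by edges with F > B e₀ changes as a block: until B e₀ rings nothing in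
it becomes fireproof, and a fire reaching one of its edges burns them all. -/
theorem foldl_step_burnt (e₀ : G.edgeSet) (h₀ : B e₀ < F e₀) (l : List ℝ)
    (hl : l.Pairwise (· < ·)) (σ : G.edgeSet → EdgeState)
    (hσ : (∀ e, Relation.ReflTransGen (Linked G fun e' => B e₀ < F e') e₀ e →
        σ e = EdgeState.burnt) ∨
      ((∀ e, Relation.ReflTransGen (Linked G fun e' => B e₀ < F e') e₀ e →
        σ e = EdgeState.inflammable) ∧ B e₀ ∈ l)) (e : G.edgeSet)
    (he : Relation.ReflTransGen (Linked G fun e' => B e₀ < F e') e₀ e) :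
    l.foldl (step G F B) σ e = EdgeState.burnt := by
  induction l generalizing σ with
  | nil => exact (hσ.resolve_right (by simp)) e he
  | cons s l ih =>
    rw [List.pairwise_cons] at hl
    refine ih hl.2 (step G F B σ s) ?_
    rcases hσ with h | ⟨h, hmem⟩
    · left
      intro e he
      simp [step, h e he]
    have fwd : ∀ e, Relation.ReflTransGen (Linked G fun e' => B e₀ < F e') e₀ e →
        Relation.ReflTransGen (SpreadsTo G σ) e₀ e := by
      intro e he
      induction he with
      | refl => exact .refl
      | tail h1 h2 ih => exact ih.tail ⟨h _ (h1.tail h2), h2.2⟩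
    have bwd : ∀ e, Relation.ReflTransGen (Linked G fun e' => B e₀ < F e') e₀ e →
        Relation.ReflTransGen (SpreadsTo G σ) e e₀ := by
      intro e he
      induction he with
      | refl => exact .refl
      | tail h1 h2 ih =>
        obtain ⟨v, hv, hv'⟩ := h2.2
        exact .head ⟨h _ h1, v, hv', hv⟩ ih
    by_cases hc : ∃ e, Relation.ReflTransGen (Linked G fun e' => B e₀ < F e') e₀ e ∧
        CatchesFire G B σ s e
    · left
      obtain ⟨e₁, h1, e₂, h2, h3, h4⟩ := hc
      intro e he
      have : CatchesFire G B σ s e := ⟨e₂, h2, h3, (h4.trans (bwd e₁ h1)).trans (fwd e he)⟩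
      simp [step, h e he, this]
    · right
      have hs : B e₀ ≠ s := fun hs =>
        hc ⟨e₀, .refl, e₀, h _ .refl, hs, .refl⟩
      have hmem := (List.mem_cons.1 hmem).resolve_left hs
      refine ⟨fun e he => ?_, hmem⟩
      -- The ring of B e₀ is still to come, so s < B e₀ < F e.
      have hF : F e ≠ s := by
        have : B e₀ < F e := by
          rcases Relation.ReflTransGen.cases_tail he with rfl | ⟨_, _, h⟩
          · exact h₀
          · exact h.1
        exact ((hl.1 _ hmem).trans this).ne'
      have hc' : ¬ CatchesFire G B σ s e := fun h => hc ⟨e, he, h⟩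
      simp [step, h e he, hc', hF]

theorem burnt_of_linked {e₀ e : G.edgeSet} (h₀ : B e₀ < F e₀)
    (he : Relation.ReflTransGen (Linked G fun e' => B e₀ < F e') e₀ e) :
    terminalState G F B e = EdgeState.burnt := by
  refine foldl_step_burnt e₀ h₀ _ (Finset.sortedLT_sort _).pairwise _
    (Or.inr ⟨fun e _ => rfl, ?_⟩) e he
  classical
  rw [Finset.mem_sort, ringTimes, Finset.mem_union]
  exact Or.inr (Finset.mem_image_of_mem _ (Finset.mem_univ _))

end Static

/-! ### Trees seen as forests rooted at a set of vertices. -/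

section Fits

variable {V : Type*} [Fintype V] [DecidableEq V]

/-- The edges of `T` which are not inside `A` are those between a vertex outside of `A` and its
parent for the forest `g` with roots `A`. -/
structure Fits (T : SimpleGraph V) (A : Finset V) (g : V → V) : Prop where
  mem : g ∈ forests A
  adj : ∀ x, x ∉ A → T.Adj x (g x)
  edge : ∀ a b, T.Adj a b → (a ∈ A ∧ b ∈ A) ∨ (a ∉ A ∧ b = g a) ∨ (b ∉ A ∧ a = g b)

variable {T : SimpleGraph V} {A : Finset V} {g : V → V} {F B : Sym2 V → ℝ}

/-- The edge between a vertex and its parent. -/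
def up (g : V → V) (x : V) : Sym2 V := s(x, g x)

/-- All the fireproofing clocks on the way from `w` to the roots are at least `s`. -/
def Late (F : Sym2 V → ℝ) (A : Finset V) (g : V → V) (s : ℝ) (w : V) : Prop :=
  ∀ i, g^[i] w ∉ A → s ≤ F (up g (g^[i] w))

theorem Late.of_mem (hg : g ∈ forests A) {s : ℝ} {w : V} (hw : w ∈ A) : Late F A g s w := by
  intro i hi
  rw [Function.iterate_fixed ((mem_forests.1 hg).1 w hw)] at hi
  exact absurd hw hi

/-- A move away from the roots adds this very edge to the way down; a move towards them removes an
edge. -/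
theorem Late.of_adj (h : Fits T A g) {s : ℝ} {a c : V} (hac : T.Adj a c) (hF : s ≤ F s(a, c))
    (ha : Late F A g s a) : Late F A g s c := by
  rcases h.edge a c hac with ⟨-, hc⟩ | ⟨-, rfl⟩ | ⟨-, rfl⟩
  · exact Late.of_mem h.mem hc
  · intro i hi
    simpa only [Function.iterate_succ_apply] using ha (i + 1) hi
  · intro i hi
    cases i with
    | zero => simpa [up, Sym2.eq_swap] using hF
    | succ i =>
      rw [Function.iterate_succ_apply] at hi ⊢
      exact ha i hi

theorem Late.of_edge (h : Fits T A g) {s : ℝ} (e : T.edgeSet) (hF : s ≤ F e) {a c : V}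
    (ha : a ∈ (e : Sym2 V)) (hc : c ∈ (e : Sym2 V)) (hl : Late F A g s a) : Late F A g s c := by
  by_cases hac : a = c
  · exact hac ▸ hl
  · have he : (e : Sym2 V) = s(a, c) := ((Sym2.mem_and_mem_iff hac).1 ⟨ha, hc⟩)
    have h2 := e.2
    rw [he] at h2 hF
    exact hl.of_adj h h2 hF

/-- Lateness is carried back along the chain from p, so a detour never replaces the direct way to
the roots. -/
theorem late_of_linked (h : Fits T A g) {p : V} (hp : p ∈ A) {s : ℝ} {e₀ e : T.edgeSet}
    (hpe : p ∈ (e : Sym2 V)) (hch : Relation.ReflTransGen (Linked T fun e' => s ≤ F e') e₀ e)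
    (hF : s ≤ F e₀) : ∀ x ∈ (e₀ : Sym2 V), Late F A g s x := by
  induction hch using Relation.ReflTransGen.head_induction_on with
  | refl => exact fun x hx => Late.of_edge h e hF hpe hx (Late.of_mem h.mem hp)
  | head h1 _ ih =>
    intro x hx
    obtain ⟨hc, v, hv, hv'⟩ := h1
    exact Late.of_edge h _ hF hv hx (ih hc v hv')

theorem exposed_cases (h : Fits T A g) {p : V} (hp : p ∈ A) {e : T.edgeSet}
    (hpe : p ∈ (e : Sym2 V)) (he : Exposed T F B e) :
    (∃ a ∈ A, ∃ b ∈ A, T.Adj a b ∧ B s(a, b) ≤ F s(a, b)) ∨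
      ∃ w, w ∉ A ∧ Late F A g (B (up g w)) w := by
  obtain ⟨⟨e₀, he₀⟩, h0, hch⟩ := he
  have key := late_of_linked h hp hpe hch h0
  induction e₀ with
  | _ a b =>
    rcases h.edge a b he₀ with ⟨ha, hb⟩ | ⟨ha, hb⟩ | ⟨hb, ha⟩
    · exact Or.inl ⟨a, ha, b, hb, he₀, h0⟩
    · refine Or.inr ⟨a, ha, ?_⟩
      have := key a (by simp)
      simp only at hb this
      rwa [hb] at this
    · refine Or.inr ⟨b, hb, ?_⟩
      have := key b (by simp)
      simp only at ha this
      rwa [ha, Sym2.eq_swap] at this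

/-- The fire started on the parent edge of w runs down to the first vertex in A and burns an edge at
it. -/
theorem exists_not_fireproof (h : Fits T A g) {w : V} (hw : w ∉ A)
    (hlt : ∀ i, g^[i] w ∉ A → B (up g w) < F (up g (g^[i] w))) :
    ∃ p ∈ A, ¬ IsFireproof T F B p := by
  obtain ⟨m, hm⟩ := (mem_forests.1 h.mem).2 w
  obtain ⟨d, -, hd, hd'⟩ := exists_first_hit hm
  obtain ⟨d, rfl⟩ : ∃ k, d = k + 1 := by
    cases d with
    | zero => exact absurd hd hw
    | succ k => exact ⟨k, rfl⟩
  have hadj : ∀ i < d + 1, up g (g^[i] w) ∈ T.edgeSet := fun i hi => h.adj _ (hd' i hi)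
  have hch : ∀ i (hi : i < d + 1), Relation.ReflTransGen
      (Linked T fun e' => B (up g w) < F e') ⟨up g w, hadj 0 (by omega)⟩
        ⟨up g (g^[i] w), hadj i hi⟩ := by
    intro i hi
    induction i with
    | zero => exact .refl
    | succ i ih =>
      refine (ih (by omega)).tail ⟨hlt _ (hd' _ hi), g^[i + 1] w, ?_, ?_⟩
      · simp [up, Function.iterate_succ_apply' g]
      · simp [up]
  have hb := burnt_of_linked (G := T) (e₀ := ⟨up g w, hadj 0 (by omega)⟩) (hlt 0 hw)
    (hch d (by omega))
  refine ⟨_, hd, fun hf => ?_⟩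
  have := hf ⟨up g (g^[d] w), hadj d (by omega)⟩ (by simp [up, Function.iterate_succ_apply' g])
  rw [this] at hb
  exact absurd hb (by simp)

/-- `u` and `v` belong to the same component of the fireproof forest. -/
def Joined (T : SimpleGraph V) (F B : Sym2 V → ℝ) (u v : V) : Prop :=
  ∃ hu hv, (fireproofForest T F B).Reachable ⟨u, hu⟩ ⟨v, hv⟩

/-- The path from u to v is closed under g, so it can serve as the root set. -/
theorem Fits.freeze_trail {v u : V} (h : Fits T {v} g) {d : ℕ} (hu : u ∈ level g {v} v d) :
    Fits T ({v} ∪ trail g u d) (freeze g ({v} ∪ trail g u d)) := by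
  have hcl : ∀ a ∈ ({v} : Finset V) ∪ trail g u d, g a ∈ ({v} : Finset V) ∪ trail g u d := by
    intro a ha
    rcases Finset.mem_union.1 ha with ha | ha
    · rw [(mem_forests.1 h.mem).1 a ha]
      exact Finset.mem_union_left _ ha
    · obtain ⟨i, hi, rfl⟩ := mem_trail.1 ha
      rw [← Function.iterate_succ_apply' g]
      rcases Nat.lt_or_ge (i + 1) d with h1 | h1
      · exact Finset.mem_union_right _ (mem_trail.2 ⟨_, h1, rfl⟩)
      · rw [show i.succ = d by omega, (mem_level.1 hu).1]
        simp
  have hv : ∀ {x}, x ∉ ({v} : Finset V) ∪ trail g u d → x ∉ ({v} : Finset V) := fun hx hx' =>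
    hx (Finset.mem_union_left _ hx')
  refine ⟨freeze_mem_forests h.mem Finset.subset_union_left, fun x hx => ?_, fun a b hab => ?_⟩
  · rw [freeze_of_notMem hx]
    exact h.adj x (hv hx)
  · rcases h.edge a b hab with ⟨ha, hb⟩ | ⟨-, rfl⟩ | ⟨-, rfl⟩
    · exact Or.inl ⟨Finset.mem_union_left _ ha, Finset.mem_union_left _ hb⟩
    · by_cases ha : a ∈ ({v} : Finset V) ∪ trail g u d
      · exact Or.inl ⟨ha, hcl a ha⟩
      · exact Or.inr (Or.inl ⟨ha, (freeze_of_notMem ha).symm⟩)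
    · by_cases hb : b ∈ ({v} : Finset V) ∪ trail g u d
      · exact Or.inl ⟨hcl b hb, hb⟩
      · exact Or.inr (Or.inr ⟨hb, (freeze_of_notMem hb).symm⟩)

theorem joined_of_fireproof {v u : V} (h : Fits T {v} g) {d : ℕ} (hu : u ∈ level g {v} v d)
    (hf : ∀ p ∈ ({v} : Finset V) ∪ trail g u d, IsFireproof T F B p) : Joined T F B u v := by
  have hmem : ∀ i ≤ d, g^[i] u ∈ ({v} : Finset V) ∪ trail g u d := by
    intro i hi
    rcases Nat.lt_or_eq_of_le hi with hi | rfl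
    · exact Finset.mem_union_right _ (mem_trail.2 ⟨i, hi, rfl⟩)
    · rw [(mem_level.1 hu).1]; simp
  have key : ∀ i (hi : i ≤ d), (fireproofForest T F B).Reachable
      ⟨u, hf _ (hmem 0 (by omega))⟩ ⟨g^[i] u, hf _ (hmem i hi)⟩ := by
    intro i hi
    induction i with
    | zero => exact SimpleGraph.Reachable.refl _
    | succ i ih =>
      refine (ih (by omega)).trans (SimpleGraph.Adj.reachable ?_)
      have hadj : s(g^[i] u, g^[i + 1] u) ∈ T.edgeSet := by
        rw [Function.iterate_succ_apply']
        exact h.adj _ ((mem_level.1 hu).2 i (by omega))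
      exact ⟨hadj, hf _ (hmem i (by omega)) ⟨_, hadj⟩ (by simp)⟩
  refine ⟨hf _ (hmem 0 (by omega)), hf v (by simp), ?_⟩
  convert key d le_rfl using 2
  exact (mem_level.1 hu).1.symm

/-- If p on the trail is not fireproof, the component of u is confined to the descendants of p: an
exit would pass through p. But v would be such a descendant only if p = v, which is fireproof. -/
theorem fireproof_of_joined {v u : V} (h : Fits T {v} g) {d : ℕ}
    (hj : Joined T F B u v) :
    ∀ p ∈ ({v} : Finset V) ∪ trail g u d, IsFireproof T F B p := by
  obtain ⟨hu', hv, hr⟩ := hj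
  intro p hp
  rcases Finset.mem_union.1 hp with hp | hp
  · rw [Finset.mem_singleton.1 hp]; exact hv
  obtain ⟨i, hi, rfl⟩ := mem_trail.1 hp
  by_contra hne
  have key : ∀ y : {y : V // IsFireproof T F B y}, (fireproofForest T F B).Reachable ⟨u, hu'⟩ y →
      ∃ m, g^[m] (y : V) = g^[i] u := by
    intro y hy
    rw [SimpleGraph.reachable_iff_reflTransGen] at hy
    induction hy with
    | refl => exact ⟨i, rfl⟩
    | @tail y z h1 h2 ih =>
      obtain ⟨m, hm⟩ := ih
      obtain ⟨hadj, -⟩ := h2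
      rcases h.edge (y : V) (z : V) hadj with ⟨ha, hb⟩ | ⟨-, hz⟩ | ⟨-, hy⟩
      · exact ⟨m, by
          rw [← hm, show (y : V) = v from Finset.mem_singleton.1 ha,
            show (z : V) = v from Finset.mem_singleton.1 hb]⟩
      · cases m with
        | zero => exact absurd (hm ▸ y.2) hne
        | succ m => exact ⟨m, by rw [show (z : V) = g y from hz, ← Function.iterate_succ_apply, hm]⟩
      · exact ⟨m + 1, by rw [Function.iterate_succ_apply, ← show (y : V) = g z from hy, hm]⟩
  obtain ⟨m, hm⟩ := key _ hr
  rw [Function.iterate_fixed ((mem_forests.1 h.mem).1 v (by simp))] at hm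
  exact hne (hm ▸ hv)

theorem Fits.adj_iff {v : V} (h : Fits T {v} g) {a b : V} :
    T.Adj a b ↔ (a ≠ v ∧ b = g a) ∨ (b ≠ v ∧ a = g b) := by
  constructor
  · intro hab
    rcases h.edge a b hab with ⟨ha, hb⟩ | ⟨ha, hb⟩ | ⟨hb, ha⟩
    · simp only [Finset.mem_singleton] at ha hb
      exact absurd (ha.trans hb.symm) hab.ne
    · exact Or.inl ⟨by simpa using ha, hb⟩
    · exact Or.inr ⟨by simpa using hb, ha⟩
  · rintro (⟨ha, rfl⟩ | ⟨hb, rfl⟩)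
    · exact h.adj a (by simpa using ha)
    · exact (h.adj b (by simpa using hb)).symm

/-- A disagreement at x forces `x = g (g' x)`, hence one at `g' x`; it climbs along g' without ever
meeting v. -/
theorem Fits.unique {v : V} {g' : V → V} (h : Fits T {v} g) (h' : Fits T {v} g') : g = g' := by
  have key : ∀ x, x ≠ v → g' x ≠ g x → g' x ≠ v ∧ g' (g' x) ≠ g (g' x) := by
    intro x hx hne
    rcases h.adj_iff.1 (h'.adj x (by simpa using hx)) with ⟨-, h1⟩ | ⟨h1, h2⟩
    · exact absurd h1 hne
    · refine ⟨h1, fun h3 => ?_⟩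
      rw [← h2] at h3
      exact iterate_ne_self h'.mem (x := x) (by simpa using hx) 1 h3
  have key2 : ∀ x, x ≠ v → g' x ≠ g x → ∀ m, g'^[m] x ≠ v := by
    intro x hx hne m
    induction m generalizing x with
    | zero => exact hx
    | succ m ih =>
      obtain ⟨h1, h2⟩ := key x hx hne
      exact ih _ h1 h2
  funext x
  by_cases hx : x = v
  · rw [hx, (mem_forests.1 h.mem).1 v (by simp), (mem_forests.1 h'.mem).1 v (by simp)]
  · by_contra hne
    obtain ⟨m, hm⟩ := (mem_forests.1 h'.mem).2 x
    exact key2 x hx (Ne.symm hne) m (by simpa using hm)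

theorem Fits.graph_unique {T' : SimpleGraph V} {v : V} (h : Fits T {v} g) (h' : Fits T' {v} g) :
    T = T' := by
  ext a b
  rw [h.adj_iff, h'.adj_iff]

/-- Take as parent a neighbour strictly closer to v. The n - 1 parent edges are distinct, so they
are all the edges of the tree. -/
theorem exists_fits_of_isTree (hT : T.IsTree) (v : V) : ∃ g, Fits T {v} g := by
  classical
  have hpar : ∀ x, x ≠ v → ∃ y, T.Adj x y ∧ T.dist y v < T.dist x v := by
    intro x hx
    obtain ⟨p, hp⟩ := hT.connected.exists_walk_length_eq_dist x v
    cases p with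
    | nil => exact absurd rfl hx
    | cons hxy q =>
      refine ⟨_, hxy, ?_⟩
      rw [← hp, SimpleGraph.Walk.length_cons]
      exact Nat.lt_succ_of_le (SimpleGraph.dist_le q)
  choose! g hadj hlt using hpar
  let g' : V → V := fun x => if x = v then v else g x
  have hg'v : g' v = v := by simp [g']
  have hg' : ∀ x, x ≠ v → g' x = g x := fun x hx => by simp [g', hx]
  have hadj' : ∀ x, x ∉ ({v} : Finset V) → T.Adj x (g' x) := fun x hx => by
    rw [hg' x (by simpa using hx)]; exact hadj x (by simpa using hx)
  have hmem : g' ∈ forests {v} := by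
    refine mem_forests.2 ⟨fun x hx => by rw [Finset.mem_singleton.1 hx, hg'v], fun x => ?_⟩
    induction hk : T.dist x v using Nat.strong_induction_on generalizing x with
    | _ k ih =>
      by_cases hx : x = v
      · exact ⟨0, by simp [hx]⟩
      · obtain ⟨m, hm⟩ := ih _ (hk ▸ hlt x hx) (g x) rfl
        exact ⟨m + 1, by rwa [Function.iterate_succ_apply, hg' x hx]⟩
  have hinj : Set.InjOn (up g') ((Finset.univ.erase v : Finset V) : Set V) := by
    intro x hx y hy hxy
    simp only [Finset.coe_erase, Finset.coe_univ, Set.mem_sdiff, Set.mem_univ, true_and,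
      Set.mem_singleton_iff] at hx hy
    simp only [up, Sym2.eq_iff] at hxy
    rcases hxy with ⟨h, -⟩ | ⟨h1, h2⟩
    · exact h
    · rw [hg' x hx] at h2
      rw [hg' y hy] at h1
      have := hlt x hx
      have := hlt y hy
      rw [h2] at *
      rw [← h1] at *
      omega
  have himg : (Finset.univ.erase v).image (up g') = T.edgeFinset := by
    refine Finset.eq_of_subset_of_card_le ?_ ?_
    · intro e he
      obtain ⟨x, hx, rfl⟩ := Finset.mem_image.1 he
      rw [SimpleGraph.mem_edgeFinset]
      exact hadj' x (by simpa using hx)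
    · rw [Finset.card_image_of_injOn hinj, Finset.card_erase_of_mem (Finset.mem_univ _),
        Finset.card_univ, ← hT.card_edgeFinset]
      simp
  refine ⟨g', hmem, hadj', fun a b hab => Or.inr ?_⟩
  have : s(a, b) ∈ (Finset.univ.erase v).image (up g') := by
    rw [himg, SimpleGraph.mem_edgeFinset]; exact hab
  obtain ⟨x, hx, hx'⟩ := Finset.mem_image.1 this
  have hx : x ∉ ({v} : Finset V) := by simpa using hx
  simp only [up, Sym2.eq_iff] at hx'
  rcases hx' with ⟨rfl, rfl⟩ | ⟨rfl, rfl⟩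
  · exact Or.inl ⟨hx, rfl⟩
  · exact Or.inr ⟨hx, rfl⟩

theorem exists_isTree_of_mem_forests {v : V} (hg : g ∈ forests {v}) :
    ∃ T : SimpleGraph V, T.IsTree ∧ Fits T {v} g := by
  classical
  have hne : ∀ x, x ≠ v → x ≠ g x := fun x hx h =>
    iterate_ne_self hg (x := x) (by simpa using hx) 0 h.symm
  let T : SimpleGraph V :=
    { Adj := fun a b => (a ≠ v ∧ b = g a) ∨ (b ≠ v ∧ a = g b)
      symm := ⟨fun a b h => h.symm⟩
      loopless := ⟨fun a h => by
        rcases h with ⟨h1, h2⟩ | ⟨h1, h2⟩ <;> exact hne a h1 h2⟩ }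
  have hfit : Fits T {v} g := by
    refine ⟨hg, fun x hx => Or.inl ⟨by simpa using hx, rfl⟩, fun a b hab => Or.inr ?_⟩
    simpa using hab
  have hreach : ∀ x, T.Reachable x v := by
    intro x
    obtain ⟨m, hm⟩ := (mem_forests.1 hg).2 x
    induction m generalizing x with
    | zero => rw [show x = v from Finset.mem_singleton.1 hm]
    | succ m ih =>
      by_cases hx : x = v
      · rw [hx]
      · exact (SimpleGraph.Adj.reachable (hfit.adj x (by simpa using hx))).trans (ih _ hm)
  have hconn : T.Connected :=
    { preconnected := fun a b => (hreach a).trans (hreach b).symm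
      nonempty := ⟨v⟩ }
  refine ⟨T, SimpleGraph.isTree_iff_connected_and_card.2 ⟨hconn, ?_⟩, hfit⟩
  refine le_antisymm ?_ hconn.card_vert_le_card_edgeSet_add_one
  have hsub : T.edgeFinset ⊆ (Finset.univ.erase v).image (up g) := by
    intro e he
    rw [SimpleGraph.mem_edgeFinset] at he
    induction e with
    | _ a b =>
      rcases he with ⟨h1, h2⟩ | ⟨h1, h2⟩
      · exact Finset.mem_image.2 ⟨a, by simpa using h1, by simp only at h2; simp [up, h2]⟩
      · exact Finset.mem_image.2 ⟨b, by simpa using h1, by simp only at h2; simp [up, h2, Sym2.eq_swap]⟩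
  have h1 := (Finset.card_le_card hsub).trans Finset.card_image_le
  rw [Finset.card_erase_of_mem (Finset.mem_univ _), Finset.card_univ,
    SimpleGraph.edgeFinset_card] at h1
  have : 0 < Fintype.card V := Fintype.card_pos_iff.2 ⟨v⟩
  rw [Nat.card_eq_fintype_card, Nat.card_eq_fintype_card]
  omega

end Fits

/-! ### Exponential clocks and races between them. -/

section Clocks

theorem expMeasure_Ioi {r t : ℝ} (hr : 0 < r) (ht : 0 ≤ t) :
    expMeasure r (Set.Ioi t) = ENNReal.ofReal (Real.exp (-(r * t))) := by
  have := isProbabilityMeasure_expMeasure hr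
  have h := cdf_expMeasure_eq hr t
  rw [cdf_eq_real, if_pos ht] at h
  rw [← Set.compl_Iic, ← ofReal_measureReal, probReal_compl_eq_one_sub measurableSet_Iic, h]
  congr 1; ring

theorem expMeasure_Ici {r t : ℝ} (hr : 0 < r) (ht : 0 ≤ t) :
    expMeasure r (Set.Ici t) = ENNReal.ofReal (Real.exp (-(r * t))) := by
  rw [← expMeasure_Ioi hr ht]
  have hac : expMeasure r ≪ volume := withDensity_absolutelyContinuous _ _
  have h : Set.Ioi t =ᵐ[expMeasure r] Set.Ici t := hac.ae_le Ioi_ae_eq_Ici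
  exact (measure_congr h).symm

/-- Laplace transform of the exponential law; negative b carry no mass, so f is prescribed for b ≥ 0
only. -/
theorem lintegral_exp_expMeasure {r c : ℝ} (hr : 0 < r) (hc : 0 ≤ c) (f : ℝ → ENNReal)
    (hf : Measurable f)
    (hf' : ∀ b, 0 ≤ b → f b = ENNReal.ofReal (Real.exp (-(c * b)))) :
    ∫⁻ b, f b ∂(expMeasure r) = ENNReal.ofReal (r / (r + c)) := by
  have hrc : 0 < r + c := by positivity
  have hm : ∀ a, Measurable (exponentialPDF a) := fun a =>
    (measurable_exponentialPDFReal a).ennreal_ofReal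
  have h0 : expMeasure r = volume.withDensity (exponentialPDF r) := rfl
  rw [h0, lintegral_withDensity_eq_lintegral_mul _ (hm r) hf]
  have h1 : ∀ b, (exponentialPDF r * f) b =
      ENNReal.ofReal (r / (r + c)) * exponentialPDF (r + c) b := by
    intro b
    rw [Pi.mul_apply]
    rcases lt_or_ge b 0 with hb | hb
    · rw [exponentialPDF_of_neg hb, exponentialPDF_of_neg hb]; simp
    · rw [exponentialPDF_of_nonneg hb, exponentialPDF_of_nonneg hb, hf' b hb,
        ← ENNReal.ofReal_mul (by positivity), ← ENNReal.ofReal_mul (by positivity)]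
      congr 1
      rw [mul_assoc, ← Real.exp_add, show -(r * b) + -(c * b) = -((r + c) * b) by ring]
      field_simp
  rw [lintegral_congr h1, lintegral_const_mul _ (hm _), lintegral_exponentialPDF_eq_one hrc,
    mul_one]

variable {ι : Type*} [Fintype ι]

/-- The law of a family of independent exponential clocks with rate `r`. -/
noncomputable abbrev clockLaw (ι : Type*) [Fintype ι] (r : ℝ) : Measure (ι → ℝ) :=
  Measure.pi fun _ : ι => expMeasure r

theorem isProbabilityMeasure_clockLaw {r : ℝ} (hr : 0 < r) :
    IsProbabilityMeasure (clockLaw ι r) := by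
  have := isProbabilityMeasure_expMeasure hr
  infer_instance

theorem clockLaw_forall {r : ℝ} (hr : 0 < r) (E : Finset ι) (I : ι → Set ℝ) :
    clockLaw ι r {F | ∀ e ∈ E, F e ∈ I e} = ∏ e ∈ E, expMeasure r (I e) := by
  have := isProbabilityMeasure_expMeasure hr
  rw [← Measure.pi_pi_finset]
  rfl

theorem clockLaw_forall_lt {r : ℝ} (hr : 0 < r) (E : Finset ι) {t : ι → ℝ}
    (ht : ∀ e ∈ E, 0 ≤ t e) :
    clockLaw ι r {F | ∀ e ∈ E, t e < F e} = ENNReal.ofReal (Real.exp (-(r * ∑ e ∈ E, t e))) := by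
  refine (clockLaw_forall hr E fun e => Set.Ioi (t e)).trans ?_
  rw [Finset.prod_congr rfl fun e he => expMeasure_Ioi hr (ht e he),
    ← ENNReal.ofReal_prod_of_nonneg fun _ _ => (Real.exp_pos _).le, ← Real.exp_sum,
    Finset.sum_neg_distrib, Finset.mul_sum]

theorem clockLaw_forall_le {r : ℝ} (hr : 0 < r) (E : Finset ι) {t : ℝ} (ht : 0 ≤ t) :
    clockLaw ι r {F | ∀ e ∈ E, t ≤ F e} = ENNReal.ofReal (Real.exp (-(r * E.card * t))) := by
  refine (clockLaw_forall hr E fun _ => Set.Ici t).trans ?_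
  rw [Finset.prod_congr rfl fun e _ => expMeasure_Ici hr ht, Finset.prod_const,
    ← ENNReal.ofReal_pow (Real.exp_pos _).le, ← Real.exp_nat_mul]
  congr 2; ring

theorem measurableSet_race (E : Finset ι) (e : ι) :
    MeasurableSet {ω : (ι → ℝ) × (ι → ℝ) | ∀ f ∈ E, ω.2 e ≤ ω.1 f} := by
  simp only [Set.ofPred_forall]
  exact Finset.measurableSet_biInter _ fun f _ => measurableSet_le (by fun_prop) (by fun_prop)

/-- The probability that the fire clock of `e` rings before all the fireproofing clocks of `E`. -/
theorem race {r : ℝ} (hr : 0 < r) (E : Finset ι) (e : ι) :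
    ((clockLaw ι 1).prod (clockLaw ι r)) {ω | ∀ f ∈ E, ω.2 e ≤ ω.1 f} =
      ENNReal.ofReal (r / (r + E.card)) := by
  have := isProbabilityMeasure_expMeasure hr
  have := isProbabilityMeasure_expMeasure one_pos
  -- Condition on the fire clock b of e: the clocks in E are all at least b with probability
  -- exp(-|E| b).
  rw [Measure.prod_apply_symm (measurableSet_race E e)]
  have hm : Measurable fun b : ℝ => clockLaw ι 1 {F | ∀ f ∈ E, b ≤ F f} := by
    refine Antitone.measurable fun a b hab => measure_mono fun F hF f hf => ?_
    exact hab.trans (hF f hf)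
  have h := (measurePreserving_eval (fun _ : ι => expMeasure r) e).lintegral_comp hm
  refine Eq.trans h (lintegral_exp_expMeasure hr (by positivity) _ hm fun b hb => ?_)
  rw [clockLaw_forall_le one_pos E hb, one_mul]

end Clocks

/-! ### Heights, and sums over the paths to a fixed vertex. -/

section Height

variable {V : Type*} [Fintype V] [DecidableEq V]

/-- The distance from `w` to the roots. -/
noncomputable def height (g : V → V) (S : Finset V) (w : V) : ℕ := sInf {m | g^[m] w ∈ S}

theorem height_spec {S : Finset V} {g : V → V} (hg : g ∈ forests S) (w : V) :
    g^[height g S w] w ∈ S ∧ w ∈ level g S (g^[height g S w] w) (height g S w) := by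
  have hne : {m | g^[m] w ∈ S}.Nonempty := (mem_forests.1 hg).2 w
  refine ⟨Nat.sInf_mem hne, mem_level.2 ⟨rfl, fun i hi h => ?_⟩⟩
  exact absurd (Nat.sInf_le (s := {m | g^[m] w ∈ S}) h) (not_le.2 hi)

theorem height_eq {S : Finset V} {g : V → V} (hg : g ∈ forests S) {s w : V} {d : ℕ} (hs : s ∈ S)
    (hw : w ∈ level g S s d) : height g S w = d := by
  obtain ⟨h1, h2⟩ := height_spec hg w
  have : Nonempty V := ⟨w⟩
  have := (root_unique hg h1 hs h2 hw (Nat.zero_le _) (Nat.zero_le _) rfl).2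
  simpa using this

theorem card_add_height_le {S : Finset V} {g : V → V} (hg : g ∈ forests S) (w : V) :
    S.card + height g S w ≤ Fintype.card V := by
  obtain ⟨h1, h2⟩ := height_spec hg w
  calc S.card + height g S w = (S ∪ trail g w (height g S w)).card := by
        rw [Finset.card_union_of_disjoint (trail_disjoint h2), card_trail h1 h2]
    _ ≤ Fintype.card V := Finset.card_le_univ _

theorem height_pos {S : Finset V} {g : V → V} (hg : g ∈ forests S) {w : V} (hw : w ∉ S) :
    0 < height g S w := by
  rcases Nat.eq_zero_or_pos (height g S w) with h | h
  · have := (height_spec hg w).1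
    rw [h] at this
    exact absurd this hw
  · exact h

/-- The vertices on the way from `u` to the root `v`. -/
noncomputable def path (g : V → V) (u v : V) : Finset V := {v} ∪ trail g u (height g {v} u)

theorem mem_level_height {g : V → V} {v : V} (hg : g ∈ forests {v}) (u : V) :
    u ∈ level g {v} v (height g {v} u) := by
  obtain ⟨h1, h2⟩ := height_spec hg u
  rwa [Finset.mem_singleton.1 h1] at h2

/-- Classified by the height d of u, this is a sum of `sumLevel`s; the path has d + 1 vertices, v
included. -/
theorem sum_path_le [Nonempty V] {v : V} {Φ : Finset V → (V → V) → ℝ}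
    {C : ℕ → ℝ} (hC : ∀ S : Finset V, S.Nonempty → ∑ g ∈ forests S, Φ S g ≤ C S.card) :
    ∑ g ∈ forests {v}, ∑ u, Φ (path g u v) (freeze g (path g u v)) ≤
      ∑ d ∈ Finset.range (Fintype.card V),
        ((Fintype.card V - 1).descFactorial d : ℝ) * C (d + 1) := by
  calc ∑ g ∈ forests {v}, ∑ u, Φ (path g u v) (freeze g (path g u v))
      ≤ ∑ g ∈ forests {v}, ∑ d ∈ Finset.range (Fintype.card V), ∑ u ∈ level g {v} v d,
          Φ ({v} ∪ trail g u d) (freeze g ({v} ∪ trail g u d)) := by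
        refine Finset.sum_le_sum fun g hg => ?_
        rw [← Finset.sum_fiberwise_of_maps_to (t := Finset.range (Fintype.card V))
          (g := fun u => height g {v} u)]
        · refine Finset.sum_le_sum fun d _ => ?_
          refine le_of_eq (Finset.sum_congr ?_ fun u hu => ?_)
          · ext u
            simp only [Finset.mem_filter, Finset.mem_univ, true_and]
            exact ⟨fun h => h ▸ mem_level_height hg u, fun h => height_eq hg (by simp) h⟩
          · rw [path, height_eq hg (by simp) hu]
        · intro u _
          have := card_add_height_le hg u
          simp at this ⊢
          omega
    _ = ∑ d ∈ Finset.range (Fintype.card V), sumLevel d {v} v Φ := Finset.sum_comm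
    _ ≤ _ := Finset.sum_le_sum fun d _ => by
        refine (sumLevel_le (by simp) d (C := C (d + 1)) fun A hA hc => ?_).trans (le_of_eq ?_)
        · rw [Finset.card_singleton, add_comm] at hc
          exact (hC A ⟨v, hA (by simp)⟩).trans (le_of_eq (by rw [hc]))
        · simp

end Height

/-! ### From the event to the path between two uniform vertices. -/

section Reduction

open Classical in
noncomputable instance (n : ℕ) : Fintype (CayleyTree n) :=
  inferInstanceAs (Fintype {G : SimpleGraph (Fin n) // G.IsTree})

instance (n : ℕ) : MeasurableSingletonClass (CayleyTree n) := ⟨fun _ => trivial⟩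

/-- A parent map rooted at 0 determines a tree and is determined by it; only this lower bound on the
number of trees is used. -/
theorem le_card_cayleyTree {n : ℕ} (hn : 0 < n) :
    (n : ℝ) ^ n / (n : ℝ) ^ 2 ≤ Fintype.card (CayleyTree n) := by
  have : Nonempty (Fin n) := ⟨⟨0, hn⟩⟩
  have h1 := card_forests_eq (V := Fin n) {⟨0, hn⟩}
  simp only [forestCount, Fintype.card_fin, Finset.card_singleton, Nat.cast_one, one_mul] at h1
  rw [← h1]
  have h2 : ∀ g : forests ({⟨0, hn⟩} : Finset (Fin n)), ∃ T : CayleyTree n,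
      Fits T.1 {⟨0, hn⟩} g.1 := fun g => by
    obtain ⟨T, hT, h⟩ := exists_isTree_of_mem_forests g.2
    exact ⟨⟨T, hT⟩, h⟩
  choose f hf using h2
  have hinj : Function.Injective f := fun g g' h => by
    have h3 := hf g'
    rw [← h] at h3
    exact Subtype.ext ((hf g).unique h3)
  have := Fintype.card_le_of_injective f hinj
  rw [Fintype.card_coe] at this
  exact_mod_cast this

/-- Subadditivity over the finitely many trees gives the upper bound with no measurability of `Ev`.
-/
theorem fireLaw_le_sum {n : ℕ} {α : ℝ} (hn : 0 < n) (Ev : Set (Sample n)) :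
    (fireLaw α n).real Ev ≤ (∑ T : CayleyTree n,
      ((clockLaw (Sym2 (Fin n)) 1).prod (clockLaw (Sym2 (Fin n)) ((n : ℝ) ^ (-α)))).real
        {ω | (T, ω) ∈ Ev}) / Fintype.card (CayleyTree n) := by
  have hr : (0 : ℝ) < (n : ℝ) ^ (-α) := by positivity
  have := isProbabilityMeasure_clockLaw (ι := Sym2 (Fin n)) hr
  have := isProbabilityMeasure_clockLaw (ι := Sym2 (Fin n)) one_pos
  set μ := (clockLaw (Sym2 (Fin n)) 1).prod (clockLaw (Sym2 (Fin n)) ((n : ℝ) ^ (-α)))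
  have h1 : Ev ⊆ ⋃ T : CayleyTree n, ({T} : Set (CayleyTree n)) ×ˢ {ω | (T, ω) ∈ Ev} := by
    rintro ⟨T, ω⟩ h
    exact Set.mem_iUnion.2 ⟨T, rfl, h⟩
  have hpos : (0 : ℝ) < Fintype.card (CayleyTree n) :=
    lt_of_lt_of_le (by positivity) (le_card_cayleyTree hn)
  have h2 : ∀ T : CayleyTree n, uniformOn (Set.univ : Set (CayleyTree n)) {T} =
      ENNReal.ofReal (1 / Fintype.card (CayleyTree n)) := fun T => by
    rw [uniformOn_univ, Measure.count_singleton, ENNReal.ofReal_div_of_pos hpos]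
    simp
  have h3 : fireLaw α n Ev ≤ ENNReal.ofReal ((∑ T : CayleyTree n, μ.real {ω | (T, ω) ∈ Ev}) /
      Fintype.card (CayleyTree n)) := by
    refine (measure_mono h1).trans ((measure_iUnion_le _).trans ?_)
    rw [tsum_fintype, Finset.sum_div, ENNReal.ofReal_sum_of_nonneg fun _ _ => by positivity]
    refine Finset.sum_le_sum fun T _ => ?_
    have h4 : fireLaw α n (({T} : Set (CayleyTree n)) ×ˢ {ω | (T, ω) ∈ Ev}) =
        uniformOn Set.univ {T} * μ {ω | (T, ω) ∈ Ev} := Measure.prod_prod _ _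
    rw [h4, h2, ← ofReal_measureReal, ← ENNReal.ofReal_mul (by positivity)]
    exact le_of_eq (by congr 1; ring)
  exact ENNReal.toReal_le_of_le_ofReal (by positivity) h3

theorem markov_count {Ω ι : Type*} [MeasurableSpace Ω] (μ : Measure Ω) [IsProbabilityMeasure μ]
    (I : Finset ι) (A : ι → Set Ω) (hA : ∀ i, MeasurableSet (A i)) (E : Set Ω) {κ : ℝ} (hκ : 0 < κ)
    (hE : ∀ ω ∈ E, ∃ J ⊆ I, κ ≤ J.card ∧ ∀ i ∈ J, ω ∈ A i) :
    μ.real E ≤ (∑ i ∈ I, μ.real (A i)) / κ := by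
  have h1 : E ⊆ {ω | ENNReal.ofReal κ ≤ ∑ i ∈ I, (A i).indicator 1 ω} := by
    intro ω hω
    obtain ⟨J, hJ, hc, hm⟩ := hE ω hω
    have h2 : (∑ i ∈ J, (A i).indicator (1 : Ω → ENNReal) ω) = J.card := by
      rw [Finset.sum_congr rfl fun i hi => Set.indicator_of_mem (hm i hi) _]
      simp
    refine le_trans ?_ (Finset.sum_le_sum_of_subset
      (f := fun i => (A i).indicator (1 : Ω → ENNReal) ω) hJ)
    rw [h2]
    exact ENNReal.ofReal_le_of_le_toReal (by simpa using hc)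
  have hm : Measurable fun ω => ∑ i ∈ I, (A i).indicator (1 : Ω → ENNReal) ω :=
    Finset.measurable_fun_sum _ fun i _ => measurable_one.indicator (hA i)
  have h2 := (measure_mono h1).trans (meas_ge_le_lintegral_div (μ := μ) hm.aemeasurable
    (ENNReal.ofReal_pos.2 hκ).ne' ENNReal.ofReal_ne_top)
  rw [lintegral_finsetSum _ fun i _ => measurable_one.indicator (hA i)] at h2
  simp only [lintegral_indicator_one (hA _)] at h2
  have h3 : (∑ i ∈ I, μ (A i)) / ENNReal.ofReal κ =
      ENNReal.ofReal ((∑ i ∈ I, μ.real (A i)) / κ) := by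
    rw [ENNReal.ofReal_div_of_pos hκ, ENNReal.ofReal_sum_of_nonneg fun _ _ => measureReal_nonneg]
    simp
  rw [h3] at h2
  exact ENNReal.toReal_le_of_le_ofReal
    (div_nonneg (Finset.sum_nonneg fun _ _ => measureReal_nonneg) hκ.le) h2

/-- `Ev` is controlled through the number of pairs whose path satisfies `A`. Since Φ sees only the
frozen forest, the sum over trees becomes one over path lengths and forests with that many roots. -/
theorem fireLaw_le {n : ℕ} (hn : 0 < n) {α : ℝ} (Ev : Set (Sample n))
    (A : Finset (Fin n) → (Fin n → Fin n) → Set ((Sym2 (Fin n) → ℝ) × (Sym2 (Fin n) → ℝ)))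
    (hA : ∀ P g, MeasurableSet (A P g)) {c : ℝ} (hc : 0 < c)
    (hEv : ∀ T ω, (T, ω) ∈ Ev → ∀ g : Fin n → Fin n → Fin n, (∀ v, Fits T.1 {v} (g v)) →
      ∃ J : Finset (Fin n × Fin n), c * (n : ℝ) ^ 2 ≤ J.card ∧
        ∀ p ∈ J, ω ∈ A (path (g p.2) p.1 p.2) (g p.2))
    {Φ : Finset (Fin n) → (Fin n → Fin n) → ℝ} (hΦ0 : ∀ A g, 0 ≤ Φ A g)
    (hΦ : ∀ v, ∀ g ∈ forests {v}, ∀ u,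
      ((clockLaw (Sym2 (Fin n)) 1).prod (clockLaw (Sym2 (Fin n)) ((n : ℝ) ^ (-α)))).real
        (A (path g u v) g) ≤ Φ (path g u v) (freeze g (path g u v)))
    {C : ℕ → ℝ}
    (hC : ∀ S : Finset (Fin n), S.Nonempty → ∑ g ∈ forests S, Φ S g ≤ C S.card) :
    (fireLaw α n).real Ev ≤
      (∑ k ∈ Finset.range n, (n.descFactorial (k + 1) : ℝ) * C (k + 1) / (n : ℝ) ^ n) / c := by
  have hr : (0 : ℝ) < (n : ℝ) ^ (-α) := by positivity
  have := isProbabilityMeasure_clockLaw (ι := Sym2 (Fin n)) hr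
  have := isProbabilityMeasure_clockLaw (ι := Sym2 (Fin n)) one_pos
  have : Nonempty (Fin n) := ⟨⟨0, hn⟩⟩
  set μ := (clockLaw (Sym2 (Fin n)) 1).prod (clockLaw (Sym2 (Fin n)) ((n : ℝ) ^ (-α)))
  have hpar : ∀ (T : CayleyTree n) v, ∃ g, Fits T.1 {v} g := fun T v =>
    exists_fits_of_isTree T.2 v
  choose g hg using hpar
  have hκ : 0 < c * (n : ℝ) ^ 2 := by positivity
  have h1 : ∀ T, μ.real {ω | (T, ω) ∈ Ev} ≤
      (∑ v, ∑ u, Φ (path (g T v) u v) (freeze (g T v) (path (g T v) u v))) /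
        (c * (n : ℝ) ^ 2) := by
    intro T
    refine (markov_count μ Finset.univ
      (fun p : Fin n × Fin n => A (path (g T p.2) p.1 p.2) (g T p.2)) (fun _ => hA _ _) _ hκ
      fun ω hω => ?_).trans ?_
    · obtain ⟨J, hJ, hJ'⟩ := hEv T ω hω (g T) (hg T)
      exact ⟨J, Finset.subset_univ _, hJ, hJ'⟩
    · gcongr
      rw [Fintype.sum_prod_type_right]
      exact Finset.sum_le_sum fun v _ => Finset.sum_le_sum fun u _ => hΦ v _ (hg T v).mem u
  have h2 : ∀ v, ∑ T, ∑ u, Φ (path (g T v) u v) (freeze (g T v) (path (g T v) u v)) ≤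
      ∑ d ∈ Finset.range n, ((n - 1).descFactorial d : ℝ) * C (d + 1) := by
    intro v
    -- Trees inject into the forests rooted at v, so the sum over trees is at most that over
    -- forests.
    have hinj : Function.Injective fun T => g T v := fun T T' h => by
      have h3 := hg T' v
      rw [← show g T v = g T' v from h] at h3
      exact Subtype.ext ((hg T v).graph_unique h3)
    refine le_trans ?_ ((sum_path_le (v := v) hC).trans (le_of_eq (by simp)))
    rw [← Finset.sum_image (f := fun g => ∑ u, Φ (path g u v) (freeze g (path g u v)))
      hinj.injOn]
    refine Finset.sum_le_sum_of_subset_of_nonneg (fun g' hg' => ?_) fun _ _ _ =>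
      Finset.sum_nonneg fun _ _ => hΦ0 _ _
    obtain ⟨T, -, rfl⟩ := Finset.mem_image.1 hg'
    exact (hg T v).mem
  have h3 : ∑ T, μ.real {ω | (T, ω) ∈ Ev} ≤
      (n * ∑ d ∈ Finset.range n, ((n - 1).descFactorial d : ℝ) * C (d + 1)) /
        (c * (n : ℝ) ^ 2) := by
    refine (Finset.sum_le_sum fun T _ => h1 T).trans ?_
    rw [← Finset.sum_div]
    gcongr
    rw [Finset.sum_comm]
    refine (Finset.sum_le_sum fun v _ => h2 v).trans (le_of_eq ?_)
    simp
  have hn' : (0 : ℝ) < n := by exact_mod_cast hn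
  have h4 : (n * ∑ d ∈ Finset.range n, ((n - 1).descFactorial d : ℝ) * C (d + 1)) =
      ∑ k ∈ Finset.range n, (n.descFactorial (k + 1) : ℝ) * C (k + 1) := by
    rw [Finset.mul_sum]
    refine Finset.sum_congr rfl fun d _ => ?_
    obtain ⟨m, rfl⟩ : ∃ m, n = m + 1 := ⟨n - 1, by omega⟩
    rw [Nat.succ_descFactorial_succ, Nat.add_sub_cancel]
    push_cast
    ring
  rw [h4] at h3
  refine (fireLaw_le_sum hn Ev).trans ?_
  rw [← Finset.sum_div]
  have h5 := (Finset.sum_nonneg fun T (_ : T ∈ Finset.univ) =>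
    measureReal_nonneg (μ := μ) (s := {ω | (T, ω) ∈ Ev})).trans h3
  generalize (∑ k ∈ Finset.range n, (n.descFactorial (k + 1) : ℝ) * C (k + 1)) = X at h3 h5 ⊢
  -- The n² pairs and the n^(n-2) trees combine to n^n.
  refine (div_le_div_of_nonneg_right h3 (Nat.cast_nonneg _)).trans
    ((div_le_div_of_nonneg_left h5 (by positivity) (le_card_cayleyTree hn)).trans (le_of_eq ?_))
  have hnn : (n : ℝ) ^ n ≠ 0 := by positivity
  field_simp

end Reduction

/-! ### Component sizes and joined pairs. -/

section Components

variable {V : Type*} [Fintype V] [DecidableEq V] {T : SimpleGraph V} {F B : Sym2 V → ℝ}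

open Classical in
theorem exists_joined_of_large {x : ℝ} (hx : 0 ≤ x) (h : HasComponentLargerThan T F B x) :
    ∃ J : Finset (V × V), x ^ 2 ≤ J.card ∧ ∀ p ∈ J, Joined T F B p.1 p.2 := by
  obtain ⟨C, hC⟩ := h
  set S : Finset V := C.supp.toFinset.image Subtype.val
  have hS : S.card = C.supp.ncard := by
    rw [Finset.card_image_of_injective _ Subtype.val_injective, Set.ncard_eq_toFinset_card']
  refine ⟨S ×ˢ S, ?_, ?_⟩
  · rw [Finset.card_product, hS]
    push_cast
    nlinarith
  · rintro ⟨u, v⟩ hp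
    obtain ⟨hu, hv⟩ := Finset.mem_product.1 hp
    obtain ⟨⟨u, hu'⟩, hu₁, rfl⟩ := Finset.mem_image.1 hu
    obtain ⟨⟨v, hv'⟩, hv₁, rfl⟩ := Finset.mem_image.1 hv
    rw [Set.mem_toFinset, SimpleGraph.ConnectedComponent.mem_supp_iff] at hu₁ hv₁
    exact ⟨hu', hv', SimpleGraph.ConnectedComponent.exact (hu₁.trans hv₁.symm)⟩

-- Each vertex is joined to at most x others, itself included.
open Classical in
theorem exists_not_joined_of_small {x : ℝ} (hx : 0 ≤ x) (h : ¬ HasComponentLargerThan T F B x) :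
    ∃ J : Finset (V × V), (Fintype.card V : ℝ) * (Fintype.card V - x) ≤ J.card ∧
      ∀ p ∈ J, ¬ Joined T F B p.1 p.2 := by
  have h1 : ∀ u, ((Finset.univ.filter fun v => Joined T F B u v).card : ℝ) ≤ x := by
    intro u
    by_cases hu : IsFireproof T F B u
    · have h2 : ¬ x < _ := fun hlt =>
        h ⟨(fireproofForest T F B).connectedComponentMk ⟨u, hu⟩, hlt⟩
      refine le_trans ?_ (not_lt.1 h2)
      rw [Set.ncard_eq_toFinset_card', ← Finset.card_image_of_injective _ Subtype.val_injective]
      refine Nat.cast_le.2 (Finset.card_le_card fun v hv => ?_)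
      obtain ⟨hu', hv', hr⟩ := (Finset.mem_filter.1 hv).2
      refine Finset.mem_image.2 ⟨⟨v, hv'⟩, ?_, rfl⟩
      rw [Set.mem_toFinset, SimpleGraph.ConnectedComponent.mem_supp_iff]
      exact SimpleGraph.ConnectedComponent.sound hr.symm
    · rw [Finset.filter_false_of_mem fun v _ hj => hu hj.1]
      simpa using hx
  refine ⟨Finset.univ.filter fun p => ¬ Joined T F B p.1 p.2, ?_, fun p hp =>
    (Finset.mem_filter.1 hp).2⟩
  have h2 : ((Finset.univ.filter fun p : V × V => Joined T F B p.1 p.2).card : ℝ) ≤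
      Fintype.card V * x := by
    have h3 : (Finset.univ.filter fun p : V × V => Joined T F B p.1 p.2).card =
        ∑ u, (Finset.univ.filter fun v => Joined T F B u v).card := by
      simp only [Finset.card_filter]
      rw [Fintype.sum_prod_type]
    rw [h3]
    push_cast
    refine (Finset.sum_le_sum fun u _ => h1 u).trans (le_of_eq ?_)
    simp
  have h4 := Finset.card_filter_add_card_filter_not (s := (Finset.univ : Finset (V × V)))
    (fun p => Joined T F B p.1 p.2)
  rw [Finset.card_univ, Fintype.card_prod] at h4
  have h5 : ((Finset.univ.filter fun p : V × V => Joined T F B p.1 p.2).card : ℝ) +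
      (Finset.univ.filter fun p : V × V => ¬ Joined T F B p.1 p.2).card =
      Fintype.card V * Fintype.card V := by exact_mod_cast h4
  linarith

end Components

/-! ### Union bound over the fires that may reach the path. -/

section Supercritical

variable {V : Type*} [Fintype V] [DecidableEq V]

theorem up_injOn {A : Finset V} {g : V → V} (hg : g ∈ forests A) :
    Set.InjOn (up g) {x | x ∉ A} := by
  intro x hx y hy hxy
  simp only [up, Sym2.eq_iff] at hxy
  rcases hxy with ⟨h, -⟩ | ⟨h1, h2⟩
  · exact h
  · exact absurd (by simp [h2, ← h1]) (iterate_ne_self hg hx 1)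

/-- The edges on the way from `w` to the roots. -/
noncomputable def branch (g : V → V) (A : Finset V) (w : V) : Finset (Sym2 V) :=
  (trail g w (height g A w)).image (up g)

theorem card_branch {A : Finset V} {g : V → V} (hg : g ∈ forests A) (w : V) :
    (branch g A w).card = height g A w := by
  obtain ⟨h1, h2⟩ := height_spec hg w
  rw [branch, Finset.card_image_of_injOn, card_trail h1 h2]
  exact (up_injOn hg).mono fun x hx => Finset.disjoint_right.1 (trail_disjoint h2) hx

/-- A fire reaches the roots. -/
def reachedEvent (A : Finset V) (g₀ : V → V) : Set ((Sym2 V → ℝ) × (Sym2 V → ℝ)) :=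
  (⋃ x ∈ A, {ω | ∀ f ∈ ({up g₀ x} : Finset (Sym2 V)), ω.2 (up g₀ x) ≤ ω.1 f}) ∪
    ⋃ w ∈ Aᶜ, {ω | ∀ f ∈ branch (freeze g₀ A) A w, ω.2 (up (freeze g₀ A) w) ≤ ω.1 f}

theorem measurableSet_reachedEvent (A : Finset V) (g₀ : V → V) :
    MeasurableSet (reachedEvent A g₀) :=
  (Finset.measurableSet_biUnion _ fun _ _ => measurableSet_race _ _).union
    (Finset.measurableSet_biUnion _ fun _ _ => measurableSet_race _ _)

theorem mem_reachedEvent {T : SimpleGraph V} {v u : V} {g : V → V} (h : Fits T {v} g)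
    {ω : (Sym2 V → ℝ) × (Sym2 V → ℝ)} (hj : ¬ Joined T ω.1 ω.2 u v) :
    ω ∈ reachedEvent (path g u v) g := by
  have hu := mem_level_height h.mem u
  have hf : Fits T (path g u v) (freeze g (path g u v)) := h.freeze_trail hu
  have h1 : ∃ p ∈ path g u v, ¬ IsFireproof T ω.1 ω.2 p := by
    by_contra hcon
    push Not at hcon
    exact hj (joined_of_fireproof h hu hcon)
  obtain ⟨p, hp, hnf⟩ := h1
  unfold IsFireproof at hnf
  push Not at hnf
  obtain ⟨e, hpe, he⟩ := hnf
  rcases exposed_cases hf hp hpe (exposed_of_not_fireproof he) with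
    ⟨a, ha, b, hb, hab, hBF⟩ | ⟨w, hw, hl⟩
  · left
    -- An edge inside the path is the parent edge of one of its ends; hence the original g, not the
    -- frozen one, in the first union.
    rcases h.adj_iff.1 hab with ⟨-, rfl⟩ | ⟨-, rfl⟩
    · exact Set.mem_biUnion ha (by simpa [up] using hBF)
    · refine Set.mem_biUnion hb ?_
      rw [Sym2.eq_swap] at hBF
      simpa [up] using hBF
  · right
    refine Set.mem_biUnion (Finset.mem_coe.2 (Finset.mem_compl.2 hw)) fun f hf' => ?_
    obtain ⟨x, hx, rfl⟩ := Finset.mem_image.1 hf'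
    obtain ⟨i, hi, rfl⟩ := mem_trail.1 hx
    exact hl i ((mem_level.1 (height_spec hf.mem w).2).2 i hi)

/-- The fire clock beats m fireproofing clocks with probability r/(r+m) ≤ r/m, where m is 1 on the
path and the height elsewhere. -/
theorem reachedEvent_le {r : ℝ} (hr : 0 < r) {A : Finset V} {g₀ : V → V}
    (hg : freeze g₀ A ∈ forests A) :
    ((clockLaw (Sym2 V) 1).prod (clockLaw (Sym2 V) r)).real (reachedEvent A g₀) ≤
      r * (A.card + ∑ w ∈ Aᶜ, 1 / (height (freeze g₀ A) A w : ℝ)) := by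
  have := isProbabilityMeasure_clockLaw (ι := Sym2 V) hr
  have := isProbabilityMeasure_clockLaw (ι := Sym2 V) one_pos
  have hrace : ∀ (E : Finset (Sym2 V)) e, 0 < E.card →
      ((clockLaw (Sym2 V) 1).prod (clockLaw (Sym2 V) r)).real
        {ω | ∀ f ∈ E, ω.2 e ≤ ω.1 f} ≤ r * (1 / E.card) := by
    intro E e hE
    rw [measureReal_def, race hr, ENNReal.toReal_ofReal (by positivity), mul_one_div]
    have : (0 : ℝ) < E.card := by exact_mod_cast hE
    gcongr
    linarith
  rw [mul_add, Finset.mul_sum]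
  refine (measureReal_union_le _ _).trans (add_le_add ?_ ?_)
  · refine (measureReal_biUnion_finset_le _ _).trans ?_
    refine (Finset.sum_le_sum fun x _ => hrace _ _ (by simp)).trans (le_of_eq ?_)
    simp [mul_comm]
  · refine (measureReal_biUnion_finset_le _ _).trans (Finset.sum_le_sum fun w hw => ?_)
    have hw : w ∉ A := by simpa using hw
    have := hrace (branch (freeze g₀ A) A w) (up (freeze g₀ A) w)
      (by rw [card_branch hg]; exact height_pos hg hw)
    rwa [card_branch hg] at this

/-- Heights above M contribute at most n/M in all; below M, the mean size (|S|+h)/|S| of a level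
above one root is summed with weight 1/h. -/
theorem sum_inv_height_le [Nonempty V] {S : Finset V} (hS : S.Nonempty) (M : ℕ) (hM : 0 < M) :
    ∑ g ∈ forests S, ∑ w ∈ Sᶜ, 1 / (height g S w : ℝ) ≤
      forestCount (Fintype.card V) S.card *
        (S.card * (∑ h ∈ Finset.Icc 1 M, 1 / (h : ℝ)) + M + Fintype.card V / M) := by
  have hn : (0 : ℝ) < Fintype.card V := by exact_mod_cast Fintype.card_pos
  set K := (Fintype.card V : ℝ) ^ Fintype.card V / (Fintype.card V : ℝ) ^ (S.card + 1) with hK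
  have h1 : ∀ g ∈ forests S, ∑ w ∈ Sᶜ, 1 / (height g S w : ℝ) ≤
      ∑ h ∈ Finset.Icc 1 M, ∑ s ∈ S, 1 / (h : ℝ) * (level g S s h).card +
        Fintype.card V / M := by
    intro g hg
    rw [← Finset.sum_filter_add_sum_filter_not Sᶜ fun w => height g S w ≤ M]
    refine add_le_add ?_ ?_
    · rw [← Finset.sum_fiberwise_of_maps_to (t := Finset.Icc 1 M) (g := fun w => height g S w)]
      · refine Finset.sum_le_sum fun h _ => ?_
        rw [← Finset.sum_fiberwise_of_maps_to (t := S) (g := fun w => g^[height g S w] w)]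
        · refine Finset.sum_le_sum fun s hs => ?_
          rw [mul_comm, ← nsmul_eq_mul]
          refine (Finset.sum_le_card_nsmul _ _ (1 / (h : ℝ)) fun w hw => ?_).trans ?_
          · simp only [Finset.mem_filter] at hw
            rw [hw.1.2]
          · refine nsmul_le_nsmul_left (by positivity) (Finset.card_le_card fun w hw => ?_)
            simp only [Finset.mem_filter] at hw
            rw [← hw.2, ← hw.1.2]
            exact (height_spec hg w).2
        · intro w _
          exact (height_spec hg w).1
      · intro w hw
        simp only [Finset.mem_filter, Finset.mem_compl] at hw
        exact Finset.mem_Icc.2 ⟨height_pos hg hw.1, hw.2⟩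
    · refine (Finset.sum_le_card_nsmul _ _ (1 / (M : ℝ)) fun w hw => ?_).trans ?_
      · simp only [Finset.mem_filter, not_le] at hw
        have : (M : ℝ) ≤ height g S w := by exact_mod_cast hw.2.le
        have : (0 : ℝ) < M := by exact_mod_cast hM
        gcongr
      · rw [nsmul_eq_mul, mul_one_div]
        gcongr
        exact Finset.card_le_univ _
  have h2 : ∑ g ∈ forests S, ∑ h ∈ Finset.Icc 1 M, ∑ s ∈ S, 1 / (h : ℝ) * (level g S s h).card ≤
      ∑ h ∈ Finset.Icc 1 M, (S.card * K) * (S.card * (1 / (h : ℝ)) + 1) := by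
    rw [Finset.sum_comm]
    refine Finset.sum_le_sum fun h hh => ?_
    have hh : (0 : ℝ) < h := by exact_mod_cast (Finset.mem_Icc.1 hh).1
    rw [Finset.sum_comm]
    calc _ ≤ ∑ s ∈ S, 1 / (h : ℝ) * ((S.card + h) * K) := Finset.sum_le_sum fun s hs => by
          rw [← Finset.mul_sum]
          exact mul_le_mul_of_nonneg_left (sum_card_level_le hs h) (by positivity)
      _ = _ := by
          rw [Finset.sum_const, nsmul_eq_mul]
          field_simp
  refine (Finset.sum_le_sum h1).trans ?_
  rw [Finset.sum_add_distrib, Finset.sum_const, nsmul_eq_mul, card_forests_eq]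
  have h3 : forestCount (Fintype.card V) S.card = S.card * K := by
    rw [forestCount, hK]; ring
  rw [h3]
  refine (add_le_add_left h2 _).trans (le_of_eq ?_)
  rw [← Finset.mul_sum, Finset.sum_add_distrib, ← Finset.mul_sum]
  simp
  ring

end Supercritical

/-! ### Chebyshev's inequality and clocks indexed by vertices. -/

section SecondMoment

/-- Chebyshev's inequality for a weighted sum of indicators. -/
theorem chebyshev_indicator {Ω ι : Type*} [MeasurableSpace Ω] (μ : Measure Ω)
    [IsProbabilityMeasure μ] (I : Finset ι) (J : ι → Set Ω) (hJ : ∀ i ∈ I, MeasurableSet (J i))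
    (c : ι → ℝ) (hc : ∀ i ∈ I, 0 ≤ c i) (q : ℝ) (hq : ∀ i ∈ I, μ.real (J i) = q)
    (D : ι → ι → ℝ) (hD : ∀ i ∈ I, ∀ j ∈ I, μ.real (J i ∩ J j) ≤ q ^ 2 + D i j) {a : ℝ}
    (ha : 0 < a) :
    μ.real {ω | ∑ i ∈ I, (J i).indicator (fun _ => c i) ω ≤ a / 2} ≤
      4 / a ^ 2 * ((q * ∑ i ∈ I, c i - a) ^ 2 + ∑ i ∈ I, ∑ j ∈ I, c i * c j * D i j) := by
  set Y : Ω → ℝ := fun ω => ∑ i ∈ I, (J i).indicator (fun _ => c i) ω with hY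
  have hint : ∀ i ∈ I, Integrable ((J i).indicator fun _ => c i) μ := fun i hi =>
    (integrable_const (c i)).indicator (hJ i hi)
  have hYint : Integrable Y μ := integrable_finsetSum _ hint
  have hY1 : ∫ ω, Y ω ∂μ = q * ∑ i ∈ I, c i := by
    rw [integral_finsetSum _ hint, Finset.mul_sum]
    refine Finset.sum_congr rfl fun i hi => ?_
    rw [integral_indicator_const _ (hJ i hi), hq i hi, smul_eq_mul]
  have hYsq : ∀ ω, Y ω ^ 2 =
      ∑ i ∈ I, ∑ j ∈ I, (J i ∩ J j).indicator (fun _ => c i * c j) ω := by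
    intro ω
    rw [sq, hY]
    simp only [Finset.sum_mul_sum]
    refine Finset.sum_congr rfl fun i _ => Finset.sum_congr rfl fun j _ => ?_
    exact (Set.inter_indicator_mul (fun _ => c i) (fun _ => c j) ω).symm
  have hint2 : ∀ i ∈ I, ∀ j ∈ I, Integrable ((J i ∩ J j).indicator fun _ => c i * c j) μ :=
    fun i hi j hj => (integrable_const _).indicator ((hJ i hi).inter (hJ j hj))
  have hYsqint : Integrable (fun ω => Y ω ^ 2) μ := by
    simp only [hYsq]
    exact integrable_finsetSum _ fun i hi => integrable_finsetSum _ fun j hj => hint2 i hi j hj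
  have hY2 : ∫ ω, Y ω ^ 2 ∂μ ≤ (q * ∑ i ∈ I, c i) ^ 2 + ∑ i ∈ I, ∑ j ∈ I, c i * c j * D i j := by
    simp only [hYsq]
    rw [integral_finsetSum _ fun i hi => integrable_finsetSum _ fun j hj => hint2 i hi j hj]
    have h1 : (q * ∑ i ∈ I, c i) ^ 2 = ∑ i ∈ I, ∑ j ∈ I, c i * c j * q ^ 2 := by
      rw [mul_pow, sq (∑ i ∈ I, c i), Finset.sum_mul_sum, mul_comm, Finset.sum_mul]
      exact Finset.sum_congr rfl fun i _ => Finset.sum_mul _ _ _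
    rw [h1, ← Finset.sum_add_distrib]
    refine Finset.sum_le_sum fun i hi => ?_
    rw [integral_finsetSum _ fun j hj => hint2 i hi j hj, ← Finset.sum_add_distrib]
    refine Finset.sum_le_sum fun j hj => ?_
    rw [integral_indicator_const _ ((hJ i hi).inter (hJ j hj)), smul_eq_mul, mul_comm, ← mul_add]
    exact mul_le_mul_of_nonneg_left (hD i hi j hj) (mul_nonneg (hc i hi) (hc j hj))
  have hZint : Integrable (fun ω => (Y ω - a) ^ 2) μ := by
    have : (fun ω => (Y ω - a) ^ 2) = fun ω => Y ω ^ 2 - 2 * a * Y ω + a ^ 2 := by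
      funext ω; ring
    rw [this]
    exact (hYsqint.sub (hYint.const_mul _)).add (integrable_const _)
  -- The level a need not be the mean of Y: the squared bias remains, and later absorbs the
  -- fluctuations of the forest.
  have hZ : ∫ ω, (Y ω - a) ^ 2 ∂μ ≤
      (q * ∑ i ∈ I, c i - a) ^ 2 + ∑ i ∈ I, ∑ j ∈ I, c i * c j * D i j := by
    have : ∫ ω, (Y ω - a) ^ 2 ∂μ = ∫ ω, Y ω ^ 2 ∂μ - 2 * a * ∫ ω, Y ω ∂μ + a ^ 2 := by
      have h1 : (fun ω => (Y ω - a) ^ 2) = fun ω => Y ω ^ 2 - 2 * a * Y ω + a ^ 2 := by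
        funext ω; ring
      have h2 : Integrable (fun ω => Y ω ^ 2 - 2 * a * Y ω) μ := hYsqint.sub (hYint.const_mul _)
      rw [h1, integral_add h2 (integrable_const _),
        integral_sub hYsqint (hYint.const_mul _), integral_const_mul]
      simp
    rw [this, hY1]
    nlinarith
  have hsub : {ω | Y ω ≤ a / 2} ⊆ {ω | a ^ 2 / 4 ≤ (Y ω - a) ^ 2} := by
    intro ω hω
    simp only [Set.mem_ofPred_eq] at hω ⊢
    nlinarith
  have hmk := mul_meas_ge_le_integral_of_nonneg (ae_of_all μ fun ω => sq_nonneg (Y ω - a)) hZint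
    (a ^ 2 / 4)
  have h5 : a ^ 2 / 4 * μ.real {ω | Y ω ≤ a / 2} ≤ a ^ 2 / 4 * μ.real _ :=
    mul_le_mul_of_nonneg_left (measureReal_mono hsub) (by positivity)
  have h6 := h5.trans (hmk.trans hZ)
  have ha2 : 0 < a ^ 2 := by positivity
  generalize μ.real {ω | Y ω ≤ a / 2} = x at h6 ⊢
  calc x = 4 / a ^ 2 * (a ^ 2 / 4 * x) := by field_simp
    _ ≤ _ := mul_le_mul_of_nonneg_left h6 (by positivity)

theorem clockLaw_forall_lt_of_injOn {ι V : Type*} [Fintype ι] {r : ℝ} (hr : 0 < r) (D : Finset V)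
    (φ : V → ι) (hφ : Set.InjOn φ D) {t : V → ℝ} (ht : ∀ x ∈ D, 0 ≤ t x) :
    clockLaw ι r {F | ∀ x ∈ D, t x < F (φ x)} =
      ENNReal.ofReal (Real.exp (-(r * ∑ x ∈ D, t x))) := by
  classical
  rcases isEmpty_or_nonempty V with hV | hV
  · have := isProbabilityMeasure_clockLaw (ι := ι) hr
    simp [Finset.eq_empty_of_isEmpty D]
  have hinv : ∀ x ∈ D, Function.invFunOn φ D (φ x) = x := fun x hx => hφ.leftInvOn_invFunOn hx
  have h := clockLaw_forall_lt hr (D.image φ) (t := fun e => t (Function.invFunOn φ D e))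
    (by
      intro e he
      obtain ⟨x, hx, rfl⟩ := Finset.mem_image.1 he
      rw [hinv x hx]
      exact ht x hx)
  rw [Finset.sum_image hφ, Finset.sum_congr rfl fun x hx => by rw [hinv x hx]] at h
  rw [← h]
  congr 1
  ext F
  simp only [Set.mem_ofPred_eq, Finset.forall_mem_image]
  exact forall₂_congr fun x hx => by rw [hinv x hx]

end SecondMoment

/-! ### Fires at bounded height above the path, for a given forest. -/

section Critical

variable {V : Type*} [Fintype V] [DecidableEq V]

/-- The vertices outside of `A` within distance `H` of `A`. -/
noncomputable def near (g : V → V) (A : Finset V) (H : ℕ) : Finset V :=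
  Finset.univ.filter fun w => height g A w ∈ Finset.Icc 1 H

theorem mem_near {g : V → V} {A : Finset V} {H : ℕ} {w : V} :
    w ∈ near g A H ↔ 1 ≤ height g A w ∧ height g A w ≤ H := by
  simp [near]

/-- All the edges between `w` and the roots stay inflammable up to a time given by the height
of `w`, if there is no fire. -/
def slow (g : V → V) (A : Finset V) (w : V) : Set (Sym2 V → ℝ) :=
  {F | ∀ x ∈ trail g w (height g A w), 1 / (height g A w : ℝ) < F (up g x)}

/-- No fire started on an edge next to the roots reaches them. -/
def resistEvent (H : ℕ) (A : Finset V) (g : V → V) : Set ((Sym2 V → ℝ) × (Sym2 V → ℝ)) :=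
  {ω | ∀ w ∈ near g A H, ω.1 ∈ slow g A w → 1 / (height g A w : ℝ) < ω.2 (up g w)}

theorem measurableSet_slow (g : V → V) (A : Finset V) (w : V) : MeasurableSet (slow g A w) := by
  simp only [slow, Set.ofPred_forall]
  exact Finset.measurableSet_biInter _ fun f _ => measurableSet_lt (by fun_prop) (by fun_prop)

theorem measurableSet_resistEvent (H : ℕ) (A : Finset V) (g : V → V) :
    MeasurableSet (resistEvent H A g) := by
  simp only [resistEvent, Set.ofPred_forall]
  refine Finset.measurableSet_biInter _ fun w _ => ?_
  have h1 : MeasurableSet {ω : (Sym2 V → ℝ) × (Sym2 V → ℝ) | ω.1 ∈ slow g A w} :=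
    measurable_fst (measurableSet_slow g A w)
  have h2 : MeasurableSet {ω : (Sym2 V → ℝ) × (Sym2 V → ℝ) |
      1 / (height g A w : ℝ) < ω.2 (up g w)} := measurableSet_lt (by fun_prop) (by fun_prop)
  have h3 := h1.compl.union h2
  convert h3 using 1
  ext ω
  simp [imp_iff_not_or]

/-- Otherwise the fire on the parent edge of some slow w, ringing by time 1/height, would burn down
to the path. -/
theorem mem_resistEvent {T : SimpleGraph V} {v u : V} {g : V → V} (h : Fits T {v} g)
    {ω : (Sym2 V → ℝ) × (Sym2 V → ℝ)} (hj : Joined T ω.1 ω.2 u v) (H : ℕ) :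
    ω ∈ resistEvent H (path g u v) (freeze g (path g u v)) := by
  have hu := mem_level_height h.mem u
  have hf : Fits T (path g u v) (freeze g (path g u v)) := h.freeze_trail hu
  intro w hw hs
  by_contra hB
  rw [not_lt] at hB
  obtain ⟨hd1, hd2⟩ := height_spec hf.mem w
  have hwA : w ∉ path g u v := (mem_level.1 hd2).2 0 (mem_near.1 hw).1
  obtain ⟨p, hp, hnf⟩ := exists_not_fireproof (B := ω.2) (F := ω.1) hf hwA fun i hi => by
    refine hB.trans_lt (hs _ (mem_trail.2 ⟨i, ?_, rfl⟩))
    by_contra hlt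
    refine hi ?_
    obtain ⟨j, hj⟩ := Nat.exists_eq_add_of_le (not_lt.1 hlt)
    rw [hj, iterate_stay hf.mem hd1]
    exact hd1
  exact hnf (fireproof_of_joined h hj p hp)

theorem slow_eq {A : Finset V} {g : V → V} (hg : g ∈ forests A) {H : ℕ} {w : V}
    (hw : w ∈ near g A H) : (clockLaw (Sym2 V) 1).real (slow g A w) = Real.exp (-1) := by
  obtain ⟨h1, h2⟩ := height_spec hg w
  have hpos : (0 : ℝ) < height g A w := by exact_mod_cast (mem_near.1 hw).1
  have := clockLaw_forall_lt_of_injOn one_pos (trail g w (height g A w)) (up g)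
    ((up_injOn hg).mono fun x hx => Finset.disjoint_right.1 (trail_disjoint h2) hx)
    (t := fun _ => 1 / (height g A w : ℝ)) (fun _ _ => by positivity)
  rw [measureReal_def, slow, this, ENNReal.toReal_ofReal (Real.exp_pos _).le, Finset.sum_const,
    card_trail h1 h2]
  congr 2
  rw [nsmul_eq_mul]
  field_simp

-- Above different roots the trails are disjoint, so the events are independent; above the same root
-- the bound 1 is enough.
open Classical in
theorem slow_inter_le {A : Finset V} {g : V → V} (hg : g ∈ forests A) {H : ℕ} {w w' : V}
    (hw : w ∈ near g A H) (hw' : w' ∈ near g A H) :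
    (clockLaw (Sym2 V) 1).real (slow g A w ∩ slow g A w') ≤
      Real.exp (-1) ^ 2 + if g^[height g A w] w = g^[height g A w'] w' then 1 else 0 := by
  have := isProbabilityMeasure_clockLaw (ι := Sym2 V) one_pos
  split_ifs with hr
  · exact measureReal_le_one.trans (by nlinarith [sq_nonneg (Real.exp (-1))])
  rw [add_zero]
  obtain ⟨h1, h2⟩ := height_spec hg w
  obtain ⟨h1', h2'⟩ := height_spec hg w'
  have hV : Nonempty V := ⟨w⟩
  have hdisj : Disjoint (trail g w (height g A w)) (trail g w' (height g A w')) := by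
    rw [Finset.disjoint_left]
    intro x hx hx'
    obtain ⟨i, hi, hi'⟩ := mem_trail.1 hx
    obtain ⟨j, hj, hj'⟩ := mem_trail.1 hx'
    exact hr (root_unique hg h1 h1' h2 h2' hi.le hj.le (hi'.trans hj'.symm)).1
  have hpos : (0 : ℝ) < height g A w := by exact_mod_cast (mem_near.1 hw).1
  have hpos' : (0 : ℝ) < height g A w' := by exact_mod_cast (mem_near.1 hw').1
  set t : V → ℝ := fun x => if x ∈ trail g w (height g A w) then 1 / (height g A w : ℝ)
    else 1 / (height g A w' : ℝ) with ht
  have ht1 : ∀ x ∈ trail g w (height g A w), t x = 1 / (height g A w : ℝ) := fun x hx => by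
    simp [ht, hx]
  have ht2 : ∀ x ∈ trail g w' (height g A w'), t x = 1 / (height g A w' : ℝ) := fun x hx => by
    simp [ht, Finset.disjoint_right.1 hdisj hx]
  have hlaw := clockLaw_forall_lt_of_injOn one_pos
    (trail g w (height g A w) ∪ trail g w' (height g A w')) (up g)
    ((up_injOn hg).mono fun x hx => by
      rcases Finset.mem_union.1 hx with hx | hx
      · exact Finset.disjoint_right.1 (trail_disjoint h2) hx
      · exact Finset.disjoint_right.1 (trail_disjoint h2') hx)
    (t := t) (fun x _ => by simp only [ht]; split_ifs <;> positivity)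
  have hset : slow g A w ∩ slow g A w' =
      {F | ∀ x ∈ trail g w (height g A w) ∪ trail g w' (height g A w'), t x < F (up g x)} := by
    ext F
    simp only [slow, Set.mem_inter_iff, Set.mem_ofPred_eq, Finset.mem_union, or_imp, forall_and]
    exact and_congr (forall₂_congr fun x hx => by rw [ht1 x hx])
      (forall₂_congr fun x hx => by rw [ht2 x hx])
  rw [hset, measureReal_def, hlaw, ENNReal.toReal_ofReal (Real.exp_pos _).le,
    Finset.sum_union hdisj, Finset.sum_congr rfl ht1, Finset.sum_congr rfl ht2, Finset.sum_const,
    Finset.sum_const, card_trail h1 h2, card_trail h1' h2', ← Real.exp_nat_mul]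
  refine le_of_eq ?_
  congr 1
  simp only [nsmul_eq_mul]
  field_simp
  norm_num

-- Let Y be the sum of 1/height over slow vertices. Where Y > a/2, the fire clocks resist with
-- conditional probability exp(-r Y); where Y ≤ a/2, Chebyshev's inequality applies.
open Classical in
theorem resistEvent_le {r : ℝ} (hr : 0 < r) {A : Finset V} {g : V → V} (hg : g ∈ forests A)
    (H : ℕ) {a : ℝ} (ha : 0 < a) :
    ((clockLaw (Sym2 V) 1).prod (clockLaw (Sym2 V) r)).real (resistEvent H A g) ≤
      Real.exp (-(r * (a / 2))) + 4 / a ^ 2 *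
        ((Real.exp (-1) * ∑ w ∈ near g A H, 1 / (height g A w : ℝ) - a) ^ 2 +
          ∑ w ∈ near g A H, ∑ w' ∈ near g A H,
            1 / (height g A w : ℝ) * (1 / (height g A w' : ℝ)) *
              if g^[height g A w] w = g^[height g A w'] w' then 1 else 0) := by
  have hp1 := isProbabilityMeasure_clockLaw (ι := Sym2 V) one_pos
  have hpr := isProbabilityMeasure_clockLaw (ι := Sym2 V) hr
  set Y : (Sym2 V → ℝ) → ℝ := fun F =>
    ∑ w ∈ near g A H, (slow g A w).indicator (fun _ => 1 / (height g A w : ℝ)) F with hY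
  have hYm : Measurable Y := Finset.measurable_fun_sum _ fun w _ =>
    measurable_const.indicator (measurableSet_slow g A w)
  have hlow : MeasurableSet {F | a / 2 < Y F} := measurableSet_lt measurable_const hYm
  have hsub : resistEvent H A g ⊆ (resistEvent H A g ∩ Prod.fst ⁻¹' {F | a / 2 < Y F}) ∪
      {F | Y F ≤ a / 2} ×ˢ Set.univ := by
    intro ω hω
    rcases lt_or_ge (a / 2) (Y ω.1) with h | h
    · exact Or.inl ⟨hω, h⟩
    · exact Or.inr ⟨h, trivial⟩
  refine (measureReal_mono hsub).trans ((measureReal_union_le _ _).trans (add_le_add ?_ ?_))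
  · refine ENNReal.toReal_le_of_le_ofReal (Real.exp_pos _).le ?_
    rw [Measure.prod_apply ((measurableSet_resistEvent H A g).inter (measurable_fst hlow))]
    have hle : ∀ F, clockLaw (Sym2 V) r (Prod.mk F ⁻¹' (resistEvent H A g ∩
        Prod.fst ⁻¹' {F | a / 2 < Y F})) ≤ ENNReal.ofReal (Real.exp (-(r * (a / 2)))) := by
      intro F
      by_cases hF : a / 2 < Y F
      · have hlaw := clockLaw_forall_lt_of_injOn hr
          ((near g A H).filter fun w => F ∈ slow g A w) (up g)
          ((up_injOn hg).mono fun w hw => by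
            have hw' := (Finset.mem_filter.1 (Finset.mem_coe.1 hw)).1
            exact (mem_level.1 (height_spec hg w).2).2 0 (mem_near.1 hw').1)
          (t := fun w => 1 / (height g A w : ℝ)) (fun _ _ => by positivity)
        have hYF : Y F = ∑ w ∈ (near g A H).filter (fun w => F ∈ slow g A w),
            1 / (height g A w : ℝ) := by
          rw [hY, Finset.sum_filter]
          exact Finset.sum_congr rfl fun w _ => by rw [Set.indicator_apply]
        rw [← hYF] at hlaw
        refine (measure_mono (t := {B : Sym2 V → ℝ | ∀ x ∈ (near g A H).filter
          (fun w => F ∈ slow g A w), 1 / (height g A x : ℝ) < B (up g x)}) ?_).trans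
          (hlaw.le.trans (ENNReal.ofReal_le_ofReal (Real.exp_le_exp.2 ?_)))
        · intro B hB w hw
          obtain ⟨hw1, hw2⟩ := Finset.mem_filter.1 hw
          exact hB.1 w hw1 hw2
        · exact neg_le_neg (mul_le_mul_of_nonneg_left hF.le hr.le)
      · have : Prod.mk F ⁻¹' (resistEvent H A g ∩ Prod.fst ⁻¹' {F | a / 2 < Y F}) = ∅ := by
          ext B
          simp [hF]
        rw [this, measure_empty]
        exact zero_le
    refine (lintegral_mono hle).trans (le_of_eq ?_)
    simp
  · have h1 : ((clockLaw (Sym2 V) 1).prod (clockLaw (Sym2 V) r)).real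
        ({F | Y F ≤ a / 2} ×ˢ Set.univ) = (clockLaw (Sym2 V) 1).real {F | Y F ≤ a / 2} := by
      rw [measureReal_def, Measure.prod_prod, measure_univ, mul_one, measureReal_def]
    rw [h1]
    exact chebyshev_indicator _ _ _ (fun w _ => measurableSet_slow g A w) _
      (fun _ _ => by positivity) _ (fun w hw => slow_eq hg hw) _
      (fun w hw w' hw' => slow_inter_le hg hw hw') ha

end Critical

/-! ### Averaging over forests: concentration of the weights above the roots. -/

section NearSums

variable {V : Type*} [Fintype V] [DecidableEq V]

/-- The sum of the inverse heights of the vertices above `s` up to height `H`. -/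
noncomputable def weightAbove (g : V → V) (A : Finset V) (H : ℕ) (s : V) : ℝ :=
  ∑ h ∈ Finset.Icc 1 H, 1 / (h : ℝ) * (level g A s h).card

theorem sum_near {A : Finset V} {g : V → V} (hg : g ∈ forests A) (H : ℕ) (f : V → ℝ) :
    ∑ w ∈ near g A H, 1 / (height g A w : ℝ) * f (g^[height g A w] w) =
      ∑ s ∈ A, weightAbove g A H s * f s := by
  rw [← Finset.sum_fiberwise_of_maps_to (t := A) (g := fun w => g^[height g A w] w)
    fun w _ => (height_spec hg w).1]
  refine Finset.sum_congr rfl fun s hs => ?_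
  rw [weightAbove, Finset.sum_mul,
    ← Finset.sum_fiberwise_of_maps_to (t := Finset.Icc 1 H) (g := fun w => height g A w)]
  · refine Finset.sum_congr rfl fun h hh => ?_
    have hset : ((near g A H).filter fun w => g^[height g A w] w = s).filter
        (fun w => height g A w = h) = level g A s h := by
      ext w
      simp only [Finset.mem_filter]
      constructor
      · rintro ⟨⟨-, h1⟩, h2⟩
        rw [← h1, ← h2]
        exact (height_spec hg w).2
      · intro hw
        have := height_eq hg hs hw
        refine ⟨⟨?_, by rw [this]; exact (mem_level.1 hw).1⟩, this⟩
        rw [near, Finset.mem_filter, this]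
        exact ⟨Finset.mem_univ _, hh⟩
    rw [hset, Finset.sum_congr rfl fun w hw => by
      rw [height_eq hg hs hw, (mem_level.1 hw).1], Finset.sum_const, nsmul_eq_mul]
    ring
  · intro w hw
    have := (Finset.mem_filter.1 hw).1
    rw [near, Finset.mem_filter] at this
    exact this.2

theorem sum_near_inv {A : Finset V} {g : V → V} (hg : g ∈ forests A) (H : ℕ) :
    ∑ w ∈ near g A H, 1 / (height g A w : ℝ) = ∑ s ∈ A, weightAbove g A H s := by
  simpa using sum_near hg H fun _ => 1

open Classical in
theorem sum_near_same_root {A : Finset V} {g : V → V} (hg : g ∈ forests A) (H : ℕ) :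
    ∑ w ∈ near g A H, ∑ w' ∈ near g A H, 1 / (height g A w : ℝ) * (1 / (height g A w' : ℝ)) *
      (if g^[height g A w] w = g^[height g A w'] w' then 1 else 0) =
      ∑ s ∈ A, weightAbove g A H s ^ 2 := by
  have h1 : ∀ s ∈ A, ∑ w' ∈ near g A H, 1 / (height g A w' : ℝ) *
      (if s = g^[height g A w'] w' then 1 else 0) = weightAbove g A H s := by
    intro s hs
    rw [sum_near hg H fun x => if s = x then 1 else 0]
    simp [hs]
  rw [Finset.sum_congr rfl fun s (_ : s ∈ A) => sq (weightAbove g A H s), ← sum_near hg H]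
  refine Finset.sum_congr rfl fun w _ => ?_
  rw [← h1 _ (height_spec hg w).1, Finset.mul_sum]
  exact Finset.sum_congr rfl fun w' _ => mul_assoc _ _ _

variable [Nonempty V]

theorem sum_weightAbove_mul (S : Finset V) (H : ℕ) (s s' : V) {X : ℝ}
    (hX : ∀ h ∈ Finset.Icc 1 H, ∀ h' ∈ Finset.Icc 1 H,
      ∑ g ∈ forests S, ((level g S s h).card : ℝ) * (level g S s' h').card ≤ X) :
    ∑ g ∈ forests S, weightAbove g S H s * weightAbove g S H s' ≤
      (∑ h ∈ Finset.Icc 1 H, 1 / (h : ℝ)) ^ 2 * X := by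
  simp only [weightAbove, Finset.sum_mul_sum]
  rw [Finset.sum_comm, sq, Finset.sum_mul_sum, Finset.sum_mul]
  refine Finset.sum_le_sum fun h hh => ?_
  rw [Finset.sum_comm, Finset.sum_mul]
  refine Finset.sum_le_sum fun h' hh' => ?_
  refine le_trans (le_of_eq ?_) (mul_le_mul_of_nonneg_left (hX h hh h' hh') (by positivity))
  rw [Finset.mul_sum]
  exact Finset.sum_congr rfl fun g _ => by ring

theorem sum_weightAbove_mul_le {S : Finset V} {s s' : V} (hs : s ∈ S) (hs' : s' ∈ S) (hne : s ≠ s')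
    (H : ℕ) :
    ∑ g ∈ forests S, weightAbove g S H s * weightAbove g S H s' ≤
      (∑ h ∈ Finset.Icc 1 H, 1 / (h : ℝ)) ^ 2 * ((S.card + 2 * H) *
        ((Fintype.card V : ℝ) ^ Fintype.card V / (Fintype.card V : ℝ) ^ (S.card + 1))) := by
  refine sum_weightAbove_mul S H s s' fun h hh h' hh' =>
    (sum_card_level_mul_le hs hs' hne h h').trans ?_
  have h1 : (h : ℝ) ≤ H := by exact_mod_cast (Finset.mem_Icc.1 hh).2
  have h2 : (h' : ℝ) ≤ H := by exact_mod_cast (Finset.mem_Icc.1 hh').2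
  rw [two_mul, ← add_assoc]
  gcongr

theorem sum_weightAbove_sq_le {S : Finset V} {s : V} (hs : s ∈ S) (H : ℕ) :
    ∑ g ∈ forests S, weightAbove g S H s ^ 2 ≤
      (∑ h ∈ Finset.Icc 1 H, 1 / (h : ℝ)) ^ 2 * ((H + 1) ^ 2 * ((S.card + 2 * H) *
        ((Fintype.card V : ℝ) ^ Fintype.card V / (Fintype.card V : ℝ) ^ (S.card + 1)))) := by
  simp only [sq (weightAbove _ S H s)]
  refine sum_weightAbove_mul S H s s fun h hh h' hh' =>
    (sum_card_level_mul_self_le hs h h').trans ?_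
  have h1 : (h : ℝ) ≤ H := by exact_mod_cast (Finset.mem_Icc.1 hh).2
  have h2 : (h' : ℝ) ≤ H := by exact_mod_cast (Finset.mem_Icc.1 hh').2
  rw [sq ((H : ℝ) + 1), two_mul, ← add_assoc]
  gcongr

/-- The size condition keeps the factor 1 - H(|S|+H)/n nonnegative, so that the lower bounds for the
levels can be weakened uniformly in h. -/
theorem le_sum_weightAbove {S : Finset V} {s : V} (hs : s ∈ S) {H : ℕ}
    (hH : H * (S.card + H) ≤ Fintype.card V) :
    (∑ h ∈ Finset.Icc 1 H, 1 / (h : ℝ)) * ((1 - H * (S.card + H) / Fintype.card V) *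
      (S.card * ((Fintype.card V : ℝ) ^ Fintype.card V /
        (Fintype.card V : ℝ) ^ (S.card + 1)))) ≤
      ∑ g ∈ forests S, weightAbove g S H s := by
  have hn : (0 : ℝ) < Fintype.card V := by exact_mod_cast Fintype.card_pos
  simp only [weightAbove]
  rw [Finset.sum_comm, Finset.sum_mul]
  refine Finset.sum_le_sum fun h hh => ?_
  obtain ⟨hh1, hh2⟩ := Finset.mem_Icc.1 hh
  have h1 : (h : ℝ) ≤ H := by exact_mod_cast hh2
  have hle : S.card + h ≤ Fintype.card V := by nlinarith
  have hH' : (H : ℝ) * (S.card + H) / Fintype.card V ≤ 1 := by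
    rw [div_le_one hn]; exact_mod_cast hH
  rw [← Finset.mul_sum]
  refine mul_le_mul_of_nonneg_left (le_trans ?_ (le_sum_card_level hs hle)) (by positivity)
  refine mul_le_mul ?_ ?_ (by positivity) ?_
  · have : (h : ℝ) * (S.card + h) / Fintype.card V ≤ H * (S.card + H) / Fintype.card V := by
      gcongr
    linarith
  · gcongr
    linarith [(Nat.cast_nonneg h : (0 : ℝ) ≤ h)]
  · have : (h : ℝ) * (S.card + h) / Fintype.card V ≤ H * (S.card + H) / Fintype.card V := by
      gcongr
    linarith

/-- With k = |S|, expanding the square leaves k² - 2k² + k² = 0 at leading order. What remains, of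
order k H³ + k² · H(k+H)/n, is small compared with k². -/
theorem sum_sq_weight_le {S : Finset V} {H : ℕ} (hH : H * (S.card + H) ≤ Fintype.card V) {L : ℝ}
    (hL : L = ∑ h ∈ Finset.Icc 1 H, 1 / (h : ℝ)) :
    ∑ g ∈ forests S, (∑ s ∈ S, weightAbove g S H s - S.card * L) ^ 2 ≤
      forestCount (Fintype.card V) S.card * L ^ 2 * ((S.card + 2 * H) * (S.card + (H + 1) ^ 2) -
        2 * S.card ^ 2 * (1 - H * (S.card + H) / Fintype.card V) + S.card ^ 2) := by
  set K := (Fintype.card V : ℝ) ^ Fintype.card V / (Fintype.card V : ℝ) ^ (S.card + 1) with hK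
  have hK0 : 0 ≤ K := by positivity
  have hN : forestCount (Fintype.card V) S.card = S.card * K := by
    rw [forestCount, hK]; ring
  have hL0 : 0 ≤ L := by rw [hL]; positivity
  have h1 : ∑ g ∈ forests S, (∑ s ∈ S, weightAbove g S H s) ^ 2 ≤
      S.card ^ 2 * (L ^ 2 * ((S.card + 2 * H) * K)) +
        S.card * (L ^ 2 * ((H + 1) ^ 2 * ((S.card + 2 * H) * K))) := by
    simp only [sq (∑ s ∈ S, weightAbove _ S H s), Finset.sum_mul_sum]
    rw [Finset.sum_comm]
    have h2 : ∀ s ∈ S, ∑ g ∈ forests S, ∑ s' ∈ S, weightAbove g S H s * weightAbove g S H s' ≤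
        S.card * (L ^ 2 * ((S.card + 2 * H) * K)) +
          L ^ 2 * ((H + 1) ^ 2 * ((S.card + 2 * H) * K)) := by
      intro s hs
      rw [Finset.sum_comm, ← Finset.sum_erase_add _ _ hs]
      refine add_le_add ?_ ?_
      · refine (Finset.sum_le_card_nsmul _ _ (L ^ 2 * ((S.card + 2 * H) * K))
          fun s' hs' => ?_).trans ?_
        · obtain ⟨hne, hs'⟩ := Finset.mem_erase.1 hs'
          rw [hL]
          exact sum_weightAbove_mul_le hs hs' hne.symm H
        · rw [nsmul_eq_mul]
          gcongr
          exact Finset.erase_subset _ _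
      · have := sum_weightAbove_sq_le hs H
        simp only [sq (weightAbove _ S H s)] at this
        rw [hL]
        exact this
    refine (Finset.sum_le_sum h2).trans (le_of_eq ?_)
    rw [Finset.sum_const, nsmul_eq_mul]
    ring
  have h3 : S.card * (L * ((1 - H * (S.card + H) / Fintype.card V) * (S.card * K))) ≤
      ∑ g ∈ forests S, ∑ s ∈ S, weightAbove g S H s := by
    rw [Finset.sum_comm, ← nsmul_eq_mul]
    refine Finset.card_nsmul_le_sum _ _ _ fun s hs => ?_
    rw [hL]
    exact le_sum_weightAbove hs hH
  have h4 : ∑ g ∈ forests S, (∑ s ∈ S, weightAbove g S H s - S.card * L) ^ 2 =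
      ∑ g ∈ forests S, (∑ s ∈ S, weightAbove g S H s) ^ 2 -
        2 * (S.card * L) * ∑ g ∈ forests S, ∑ s ∈ S, weightAbove g S H s +
          S.card * K * (S.card * L) ^ 2 := by
    rw [← hN, ← card_forests_eq, ← nsmul_eq_mul (forests S).card, ← Finset.sum_const,
      Finset.mul_sum, ← Finset.sum_sub_distrib, ← Finset.sum_add_distrib]
    exact Finset.sum_congr rfl fun g _ => by ring
  have h5 := mul_le_mul_of_nonneg_left h3 (show 0 ≤ 2 * ((S.card : ℝ) * L) by positivity)
  rw [h4, hN]
  refine (add_le_add_left (sub_le_sub h1 h5) _).trans (le_of_eq ?_)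
  ring

/-- The constant is 88 = 4 · (4 + 9 · 2): the 4 inside bounds the forest fluctuations, 9 · 2 the
pairs above a common root. -/
theorem variance_bound {k H q L N : ℝ} (hk : 1 ≤ k) (hH : 1 ≤ H) (hq : 0 < q)
    (hq9 : 1 / q ^ 2 ≤ 9) (hL : 0 < L) (hN : 0 ≤ N) (δ : ℝ) :
    4 / (q * (k * L)) ^ 2 * (q ^ 2 * (N * L ^ 2 * ((k + 2 * H) * (k + (H + 1) ^ 2) -
      2 * k ^ 2 * (1 - δ) + k ^ 2)) + N * L ^ 2 * ((H + 1) ^ 2 * (k + 2 * H))) ≤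
      N * (88 * (H + 1) ^ 3 / k + 8 * δ) := by
  have hk0 : 0 < k := by linarith
  have hid : ∀ X Z : ℝ, 4 / (q * (k * L)) ^ 2 * (q ^ 2 * (N * L ^ 2 * X) + N * L ^ 2 * Z) =
      N * (4 / k ^ 2 * (X + 1 / q ^ 2 * Z)) := fun X Z => by field_simp
  rw [hid]
  refine mul_le_mul_of_nonneg_left ?_ hN
  have h1 : 1 / q ^ 2 * ((H + 1) ^ 2 * (k + 2 * H)) ≤ 9 * ((H + 1) ^ 2 * (k + 2 * H)) :=
    mul_le_mul_of_nonneg_right hq9 (by positivity)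
  have h2 : k + 2 * H ≤ k * (2 * (H + 1)) := by nlinarith
  have h3 : (H + 1) ^ 2 * (k + 2 * H) ≤ (H + 1) ^ 2 * (k * (2 * (H + 1))) :=
    mul_le_mul_of_nonneg_left h2 (by positivity)
  have h4 : 2 * H * (H + 1) ^ 2 ≤ 2 * H * (H + 1) ^ 2 * k :=
    le_mul_of_one_le_right (by positivity) hk
  have h5 : (H + 1) ^ 2 + 2 * H + 2 * H * (H + 1) ^ 2 ≤ 4 * (H + 1) ^ 3 := by
    nlinarith [sq_nonneg H, pow_pos (by linarith : (0 : ℝ) < H) 3]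
  have h6 := mul_le_mul_of_nonneg_right h5 hk0.le
  have h7 : (k + 2 * H) * (k + (H + 1) ^ 2) - 2 * k ^ 2 * (1 - δ) + k ^ 2 +
      1 / q ^ 2 * ((H + 1) ^ 2 * (k + 2 * H)) ≤ 22 * (H + 1) ^ 3 * k + 2 * k ^ 2 * δ := by
    linarith
  refine (mul_le_mul_of_nonneg_left h7 (by positivity)).trans (le_of_eq ?_)
  field_simp
  ring

theorem sum_resistEvent_le {r : ℝ} (hr : 0 < r) {S : Finset V} (hS : S.Nonempty) {H : ℕ}
    (hH1 : 1 ≤ H) (hH : H * (S.card + H) ≤ Fintype.card V) :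
    ∑ g ∈ forests S,
      ((clockLaw (Sym2 V) 1).prod (clockLaw (Sym2 V) r)).real (resistEvent H S g) ≤
    forestCount (Fintype.card V) S.card *
      (Real.exp (-(r * (Real.exp (-1) * (S.card * ∑ h ∈ Finset.Icc 1 H, 1 / (h : ℝ)) / 2))) +
        88 * (H + 1) ^ 3 / S.card + 8 * H * (S.card + H) / Fintype.card V) := by
  classical
  set L := ∑ h ∈ Finset.Icc 1 H, 1 / (h : ℝ) with hL
  have hk : (1 : ℝ) ≤ S.card := by exact_mod_cast hS.card_pos
  have hk0 : (0 : ℝ) < S.card := by linarith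
  have hHr : (1 : ℝ) ≤ H := by exact_mod_cast hH1
  have hLpos : 0 < L := by
    refine Finset.sum_pos (fun h hh => ?_) ⟨1, Finset.mem_Icc.2 ⟨le_rfl, hH1⟩⟩
    have : (0 : ℝ) < h := by exact_mod_cast (Finset.mem_Icc.1 hh).1
    positivity
  have hqpos := Real.exp_pos (-1)
  set q := Real.exp (-1) with hq
  have hq3 : 1 / q ^ 2 ≤ 9 := by
    have h1 : 1 / q = Real.exp 1 := by rw [hq, Real.exp_neg]; simp
    have h2 : Real.exp 1 ≤ 3 := Real.exp_one_lt_three.le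
    rw [← one_div_pow, h1]
    nlinarith [Real.exp_pos 1]
  -- Approximate mean of Y: each root carries weight about L, thinned by the probability q = 1/e of
  -- being slow.
  set a := q * (S.card * L) with ha
  have hapos : 0 < a := by positivity
  set N := forestCount (Fintype.card V) S.card with hN
  have hN0 : 0 ≤ N := forestCount_nonneg _ _
  have hn : (0 : ℝ) < Fintype.card V := by exact_mod_cast Fintype.card_pos
  have hD : ∑ g ∈ forests S, ∑ s ∈ S, weightAbove g S H s ^ 2 ≤
      N * L ^ 2 * ((H + 1) ^ 2 * (S.card + 2 * H)) := by
    rw [Finset.sum_comm]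
    refine (Finset.sum_le_sum fun s hs => sum_weightAbove_sq_le hs H).trans (le_of_eq ?_)
    rw [Finset.sum_const, nsmul_eq_mul, hN, forestCount, ← hL]
    ring
  have hM := sum_sq_weight_le hH hL
  rw [← hN] at hM
  have h1 : ∑ g ∈ forests S,
      ((clockLaw (Sym2 V) 1).prod (clockLaw (Sym2 V) r)).real (resistEvent H S g) ≤
      ∑ g ∈ forests S, (Real.exp (-(r * (a / 2))) + 4 / a ^ 2 *
        (q ^ 2 * (∑ s ∈ S, weightAbove g S H s - S.card * L) ^ 2 +
          ∑ s ∈ S, weightAbove g S H s ^ 2)) := by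
    refine Finset.sum_le_sum fun g hg => (resistEvent_le hr hg H hapos).trans (le_of_eq ?_)
    have h2 : q * ∑ s ∈ S, weightAbove g S H s - a =
        q * (∑ s ∈ S, weightAbove g S H s - S.card * L) := by rw [ha]; ring
    rw [sum_near_same_root hg, sum_near_inv hg, ← hq, h2, mul_pow q (∑ s ∈ S, weightAbove g S H s - S.card * L)]
  refine h1.trans ?_
  rw [Finset.sum_add_distrib, Finset.sum_const, nsmul_eq_mul, card_forests_eq, ← hN,
    ← Finset.mul_sum, Finset.sum_add_distrib, ← Finset.mul_sum]
  have h2 : 4 / a ^ 2 * (q ^ 2 * ∑ g ∈ forests S,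
        (∑ s ∈ S, weightAbove g S H s - S.card * L) ^ 2 +
      ∑ g ∈ forests S, ∑ s ∈ S, weightAbove g S H s ^ 2) ≤
      N * (88 * (H + 1) ^ 3 / S.card + 8 * H * (S.card + H) / Fintype.card V) := by
    refine le_trans ?_ (variance_bound hk hHr hqpos hq3 hLpos hN0
      (H * (S.card + H) / Fintype.card V)) |>.trans (le_of_eq (by ring))
    rw [← ha]
    gcongr
  refine (add_le_add_right h2 _).trans (le_of_eq ?_)
  rw [ha]
  ring

end NearSums

/-! ### The law of the number of vertices on the path. -/

section PathLength

/-- The probability that the path between two uniform vertices of a uniform tree with `n` vertices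
has `k` vertices. -/
noncomputable def pathProb (n k : ℕ) : ℝ :=
  (n.descFactorial k : ℝ) * forestCount n k / (n : ℝ) ^ n

/-- The probability that the path between two uniform vertices of a uniform tree with `n` vertices
has at least `k` vertices. -/
noncomputable def pathTail (n k : ℕ) : ℝ := (n.descFactorial k : ℝ) / (n : ℝ) ^ k

theorem pathProb_nonneg (n k : ℕ) : 0 ≤ pathProb n k := by
  have := forestCount_nonneg n k
  unfold pathProb; positivity

theorem pathTail_nonneg (n k : ℕ) : 0 ≤ pathTail n k := by
  unfold pathTail; positivity

theorem pathTail_le_one (n k : ℕ) : pathTail n k ≤ 1 := by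
  unfold pathTail
  refine div_le_one_of_le₀ ?_ (by positivity)
  exact_mod_cast Nat.descFactorial_le_pow n k

theorem pathProb_eq {n : ℕ} (hn : 0 < n) (k : ℕ) : pathProb n k = pathTail n k * (k / n) := by
  have : (n : ℝ) ≠ 0 := by positivity
  unfold pathProb pathTail forestCount
  rw [pow_succ]
  field_simp

/-- As in the birthday problem, a path with at least k vertices stops at k with probability k/n. -/
theorem pathProb_eq_sub {n k : ℕ} (hn : 0 < n) (hk : k ≤ n) :
    pathProb n k = pathTail n k - pathTail n (k + 1) := by
  have : (n : ℝ) ≠ 0 := by positivity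
  rw [pathProb_eq hn]
  unfold pathTail
  rw [Nat.descFactorial_succ, pow_succ]
  push_cast [Nat.cast_sub hk]
  field_simp
  ring

theorem pathProb_le {n : ℕ} (hn : 0 < n) (k : ℕ) : pathProb n k ≤ k / n := by
  rw [pathProb_eq hn]
  exact mul_le_of_le_one_left (by positivity) (pathTail_le_one n k)

theorem sum_pathProb_le_one {n : ℕ} (hn : 0 < n) :
    ∑ k ∈ Finset.range n, pathProb n (k + 1) ≤ 1 := by
  have h : ∀ m ≤ n, ∑ k ∈ Finset.range m, pathProb n (k + 1) =
      pathTail n 1 - pathTail n (m + 1) := by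
    intro m hm
    induction m with
    | zero => simp
    | succ m ih =>
      rw [Finset.sum_range_succ, ih (by omega), pathProb_eq_sub hn hm]
      ring
  rw [h n le_rfl]
  linarith [pathTail_le_one n 1, pathTail_nonneg n (n + 1)]

theorem card_filter_succ_le {x : ℝ} (hx : 0 ≤ x) (n : ℕ) :
    (((Finset.range n).filter fun k : ℕ => ((k + 1 : ℕ) : ℝ) ≤ x).card : ℝ) ≤ x := by
  refine le_trans ?_ (Nat.floor_le hx)
  rw [← Finset.card_range ⌊x⌋₊]
  refine Nat.cast_le.2 (Finset.card_le_card fun k hk => ?_)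
  rw [Finset.mem_range]
  exact Nat.le_floor (Finset.mem_filter.1 hk).2

/-- Abel summation turns the mean into the sum of the tails. At most √n of them have index up to √n;
beyond, a tail is at most √n times the probability, because k/n ≥ 1/√n. -/
theorem sum_mul_pathProb_le {n : ℕ} (hn : 0 < n) :
    ∑ k ∈ Finset.range n, ((k + 1 : ℕ) : ℝ) * pathProb n (k + 1) ≤ 2 * √n := by
  have hn' : (0 : ℝ) < n := by exact_mod_cast hn
  have hs : 0 < √(n : ℝ) := Real.sqrt_pos.2 hn'
  have h : ∀ m ≤ n, ∑ k ∈ Finset.range m, ((k + 1 : ℕ) : ℝ) * pathProb n (k + 1) =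
      ∑ k ∈ Finset.range m, pathTail n (k + 1) - m * pathTail n (m + 1) := by
    intro m hm
    induction m with
    | zero => simp
    | succ m ih =>
      rw [Finset.sum_range_succ, ih (by omega), pathProb_eq_sub hn hm, Finset.sum_range_succ]
      push_cast
      ring
  rw [h n le_rfl]
  have h1 : ∀ k ∈ Finset.range n, pathTail n (k + 1) ≤
      (if ((k + 1 : ℕ) : ℝ) ≤ √n then 1 else 0) + √n * pathProb n (k + 1) := by
    intro k _
    split_ifs with hk
    · have := mul_nonneg hs.le (pathProb_nonneg n (k + 1))
      linarith [pathTail_le_one n (k + 1)]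
    · rw [pathProb_eq hn, zero_add]
      have h2 : 1 ≤ √n * (((k + 1 : ℕ) : ℝ) / n) := by
        rw [← mul_div_assoc, le_div_iff₀ hn', one_mul]
        nlinarith [Real.mul_self_sqrt hn'.le]
      nlinarith [pathTail_nonneg n (k + 1)]
  have h2 := Finset.sum_le_sum h1
  rw [Finset.sum_add_distrib, ← Finset.mul_sum, Finset.sum_boole] at h2
  have h3 := card_filter_succ_le hs.le n
  have h4 := mul_le_mul_of_nonneg_left (sum_pathProb_le_one hn) hs.le
  have h5 := mul_nonneg hn'.le (pathTail_nonneg n (n + 1))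
  linarith

theorem sum_small_pathProb_le {n : ℕ} (hn : 0 < n) {δ : ℝ} (hδ : 0 ≤ δ) :
    ∑ k ∈ Finset.range n, pathProb n (k + 1) *
      (if ((k + 1 : ℕ) : ℝ) ≤ δ * √n then 1 else 0) ≤ δ ^ 2 := by
  have hn' : (0 : ℝ) < n := by exact_mod_cast hn
  have hx : 0 ≤ δ * √n := by positivity
  calc _ ≤ ∑ k ∈ Finset.range n, δ * √n / n *
      (if ((k + 1 : ℕ) : ℝ) ≤ δ * √n then 1 else 0) := by
        refine Finset.sum_le_sum fun k _ => ?_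
        split_ifs with hk
        · rw [mul_one, mul_one]
          exact (pathProb_le hn _).trans (by gcongr)
        · simp
    _ ≤ δ * √n / n * (δ * √n) := by
        rw [← Finset.mul_sum, Finset.sum_boole]
        exact mul_le_mul_of_nonneg_left (card_filter_succ_le hx n) (by positivity)
    _ = δ ^ 2 := by
        rw [div_mul_eq_mul_div, div_eq_iff hn'.ne']
        linear_combination δ ^ 2 * Real.mul_self_sqrt hn'.le

end PathLength

/-! ### Explicit bounds for fixed n. -/

section Assembly

theorem freeze_path_mem_forests {V : Type*} [Fintype V] [DecidableEq V] {v : V} {g : V → V}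
    (hg : g ∈ forests {v}) (u : V) : freeze g (path g u v) ∈ forests (path g u v) :=
  freeze_mem_forests hg Finset.subset_union_left

theorem fireLaw_small_le {n : ℕ} (hn : 0 < n) {α ε : ℝ} (hε : 0 < ε) (hε1 : ε < 1) :
    (fireLaw α n).real (largeComponentEvent n ((1 - ε) * (n : ℝ)))ᶜ ≤
      (n : ℝ) ^ (-α) * (√n * (7 + 2 * Real.log n)) / ε := by
  have hr : (0 : ℝ) < (n : ℝ) ^ (-α) := by positivity
  have hV : Nonempty (Fin n) := ⟨⟨0, hn⟩⟩
  have hn' : (0 : ℝ) < n := by exact_mod_cast hn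
  have hn1 : (1 : ℝ) ≤ n := by exact_mod_cast hn
  have hs : 1 ≤ √(n : ℝ) := Real.one_le_sqrt.2 hn1
  set r := (n : ℝ) ^ (-α)
  -- This cut-off balances the terms M and n/M.
  set M := ⌈√(n : ℝ)⌉₊ with hM
  have hM1 : √(n : ℝ) ≤ M := Nat.le_ceil _
  have hM2 : (M : ℝ) ≤ √n + 1 := (Nat.ceil_lt_add_one (by positivity)).le
  have hM0 : 0 < M := Nat.ceil_pos.2 (by linarith)
  have hMn : M ≤ n := Nat.ceil_le.2 (by
    rw [Real.sqrt_le_left hn'.le]; nlinarith)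
  set L := ∑ h ∈ Finset.Icc 1 M, 1 / (h : ℝ) with hL
  have hLle : L ≤ 1 + Real.log n := by
    have h1 := harmonic_le_one_add_log M
    have h2 : ((harmonic M : ℚ) : ℝ) = L := by
      rw [harmonic_eq_sum_Icc, hL]
      push_cast
      simp
    rw [h2] at h1
    have h3 : Real.log M ≤ Real.log n :=
      Real.log_le_log (by exact_mod_cast hM0) (by exact_mod_cast hMn)
    linarith
  have hL0 : 0 ≤ L := by rw [hL]; positivity
  have hmain := fireLaw_le hn (α := α) (largeComponentEvent n ((1 - ε) * (n : ℝ)))ᶜ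
    (fun P g => reachedEvent P g) (fun P g => measurableSet_reachedEvent P g) hε
    (fun T ω hω g hg => ?_)
    (Φ := fun S g => r * (S.card + ∑ w ∈ Sᶜ, 1 / (height g S w : ℝ)))
    (fun A g => by positivity)
    (fun v g hg u => reachedEvent_le hr (freeze_path_mem_forests hg u))
    (C := fun k => r * (forestCount n k * (k * (1 + L) + (M + n / M))))
    (fun S hS => ?_)
  · refine hmain.trans ?_
    gcongr
    have h1 : ∀ k ∈ Finset.range n, (n.descFactorial (k + 1) : ℝ) *
        (r * (forestCount n (k + 1) * (((k + 1 : ℕ) : ℝ) * (1 + L) + (M + n / M)))) / (n : ℝ) ^ n =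
        r * ((1 + L) * (((k + 1 : ℕ) : ℝ) * pathProb n (k + 1)) +
          (M + n / M) * pathProb n (k + 1)) := by
      intro k _
      unfold pathProb
      ring
    rw [Finset.sum_congr rfl h1, ← Finset.mul_sum]
    refine mul_le_mul_of_nonneg_left ?_ hr.le
    rw [Finset.sum_add_distrib, ← Finset.mul_sum, ← Finset.mul_sum]
    -- This term is at most (4 + 2 log n) √n, and M + n/M ≤ 3 √n, whence 7 + 2 log n.
    have h2 := mul_le_mul_of_nonneg_left (sum_mul_pathProb_le hn) (by linarith : 0 ≤ 1 + L)
    have h3 : (n : ℝ) / M ≤ √n := by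
      rw [div_le_iff₀ (by exact_mod_cast hM0)]
      nlinarith [Real.mul_self_sqrt hn'.le]
    have h4 := mul_le_mul_of_nonneg_left (sum_pathProb_le_one hn)
      (show (0 : ℝ) ≤ M + n / M by positivity)
    nlinarith
  · obtain ⟨J, hJ, hJ'⟩ := exists_not_joined_of_small (x := (1 - ε) * (n : ℝ))
      (mul_nonneg (by linarith) hn'.le) hω
    refine ⟨J, le_trans (le_of_eq ?_) hJ, fun p hp => mem_reachedEvent (hg p.2) (hJ' p hp)⟩
    rw [Fintype.card_fin]
    ring
  · rw [← Finset.mul_sum, Finset.sum_add_distrib, Finset.sum_const, nsmul_eq_mul, card_forests_eq]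
    refine mul_le_mul_of_nonneg_left ?_ hr.le
    have h1 := sum_inv_height_le hS M hM0
    rw [Fintype.card_fin] at h1 ⊢
    refine (add_le_add_right h1 _).trans (le_of_eq ?_)
    rw [← hL]
    ring

theorem fireLaw_large_le {n : ℕ} (hn : 0 < n) {ε : ℝ} (hε : 0 < ε) {δ a : ℝ} (hδ : 0 < δ)
    (ha : 0 < a) {H : ℕ} (hH1 : 1 ≤ H) (hH : H * (a * √n + H) ≤ n) :
    (fireLaw (1 / 2) n).real (largeComponentEvent n (ε * (n : ℝ))) ≤
      (δ ^ 2 + 2 / a + (Real.exp (-(Real.exp (-1) * δ / 2 * ∑ h ∈ Finset.Icc 1 H, 1 / (h : ℝ))) +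
        88 * (H + 1) ^ 3 / (δ * √n) + 8 * H * (a * √n + H) / n)) / ε ^ 2 := by
  have hV : Nonempty (Fin n) := ⟨⟨0, hn⟩⟩
  have hn' : (0 : ℝ) < n := by exact_mod_cast hn
  have hs : 0 < √(n : ℝ) := Real.sqrt_pos.2 hn'
  have hr : (0 : ℝ) < (n : ℝ) ^ (-(1 / 2) : ℝ) := by positivity
  have hrs : (n : ℝ) ^ (-(1 / 2) : ℝ) * √n = 1 := by
    rw [Real.rpow_neg hn'.le, ← Real.sqrt_eq_rpow]
    field_simp
  have hp1 := isProbabilityMeasure_clockLaw (ι := Sym2 (Fin n)) one_pos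
  have hpr := isProbabilityMeasure_clockLaw (ι := Sym2 (Fin n)) hr
  set r := (n : ℝ) ^ (-(1 / 2) : ℝ)
  set L := ∑ h ∈ Finset.Icc 1 H, 1 / (h : ℝ) with hL
  have hL0 : 0 ≤ L := by rw [hL]; positivity
  set η := Real.exp (-(Real.exp (-1) * δ / 2 * L)) +
        88 * (H + 1) ^ 3 / (δ * √n) + 8 * H * (a * √n + H) / n with hη
  have hη0 : 0 ≤ η := by positivity
  have hmain := fireLaw_le hn (α := 1 / 2) (largeComponentEvent n (ε * (n : ℝ)))
    (fun P g => resistEvent H P (freeze g P)) (fun P g => measurableSet_resistEvent H P _)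
    (c := ε ^ 2) (by positivity)
    (fun T ω hω g hg => ?_)
    (Φ := fun S g => ((clockLaw (Sym2 (Fin n)) 1).prod (clockLaw (Sym2 (Fin n)) r)).real
      (resistEvent H S g))
    (fun A g => measureReal_nonneg)
    (fun v g hg u => le_rfl)
    (C := fun k => forestCount n k *
      ((if (k : ℝ) ≤ δ * √n then 1 else 0) + k / (a * √n) + η))
    (fun S hS => ?_)
  · refine hmain.trans ?_
    gcongr
    have h1 : ∀ k ∈ Finset.range n, (n.descFactorial (k + 1) : ℝ) *
        (forestCount n (k + 1) * ((if ((k + 1 : ℕ) : ℝ) ≤ δ * √n then 1 else 0) +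
          ((k + 1 : ℕ) : ℝ) / (a * √n) + η)) / (n : ℝ) ^ n =
        pathProb n (k + 1) * (if ((k + 1 : ℕ) : ℝ) ≤ δ * √n then 1 else 0) +
          1 / (a * √n) * (((k + 1 : ℕ) : ℝ) * pathProb n (k + 1)) + η * pathProb n (k + 1) := by
      intro k _
      unfold pathProb
      ring
    rw [Finset.sum_congr rfl h1, Finset.sum_add_distrib, Finset.sum_add_distrib, ← Finset.mul_sum,
      ← Finset.mul_sum]
    refine add_le_add (add_le_add (sum_small_pathProb_le hn hδ.le) ?_)
      (mul_le_of_le_one_right hη0 (sum_pathProb_le_one hn))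
    refine (mul_le_mul_of_nonneg_left (sum_mul_pathProb_le hn) (by positivity)).trans (le_of_eq ?_)
    field_simp
  · obtain ⟨J, hJ, hJ'⟩ := exists_joined_of_large (x := ε * (n : ℝ)) (by positivity) hω
    exact ⟨J, le_trans (le_of_eq (by ring)) hJ, fun p hp => mem_resistEvent (hg p.2) (hJ' p hp) H⟩
  · have htriv : ∑ g ∈ forests S, ((clockLaw (Sym2 (Fin n)) 1).prod
        (clockLaw (Sym2 (Fin n)) r)).real (resistEvent H S g) ≤ forestCount n S.card * 1 := by
      refine (Finset.sum_le_card_nsmul _ _ 1 fun g _ => measureReal_le_one).trans (le_of_eq ?_)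
      rw [nsmul_eq_mul, card_forests_eq, Fintype.card_fin]
    have hN := forestCount_nonneg n S.card
    have hk0 : (0 : ℝ) < S.card := by exact_mod_cast hS.card_pos
    have hq : 0 ≤ (S.card : ℝ) / (a * √n) := by positivity
    -- Short paths (total probability at most δ²) and long ones (at most 2/a, by Markov) get the
    -- trivial bound 1; only intermediate lengths use the fires.
    by_cases h1 : (S.card : ℝ) ≤ δ * √n
    · refine htriv.trans (mul_le_mul_of_nonneg_left ?_ hN)
      rw [if_pos h1]
      linarith
    by_cases h2 : a * √n ≤ S.card
    · refine htriv.trans (mul_le_mul_of_nonneg_left ?_ hN)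
      have : 1 ≤ (S.card : ℝ) / (a * √n) := by
        rw [le_div_iff₀ (by positivity)]; linarith
      rw [if_neg h1]
      linarith
    rw [not_le] at h1 h2
    have hHn : H * (S.card + H) ≤ Fintype.card (Fin n) := by
      rw [Fintype.card_fin]
      have : (H : ℝ) * (S.card + H) ≤ n := le_trans (by gcongr) hH
      exact_mod_cast this
    refine (sum_resistEvent_le hr hS hH1 hHn).trans ?_
    rw [Fintype.card_fin, ← hL, if_neg (not_le.2 h1), zero_add]
    refine mul_le_mul_of_nonneg_left ?_ hN
    refine le_trans ?_ (le_add_of_nonneg_left hq)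
    rw [hη]
    refine add_le_add (add_le_add (Real.exp_le_exp.2 (neg_le_neg ?_)) ?_) ?_
    -- Criticality enters here: r √n = 1, so a path with more than δ√n vertices has r |S| ≥ δ.
    · have h3 : δ ≤ r * S.card := by
        calc δ = r * (δ * √n) := by linear_combination -δ * hrs
          _ ≤ r * S.card := by gcongr
      calc Real.exp (-1) * δ / 2 * L ≤ Real.exp (-1) * (r * S.card) / 2 * L := by gcongr
        _ = _ := by ring
    · gcongr
    · gcongr

end Assembly

/-! ### Passage to the limit. -/

section Limits

theorem isProbabilityMeasure_fireLaw (α : ℝ) {n : ℕ} (hn : 0 < n) :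
    IsProbabilityMeasure (fireLaw α n) := by
  have hr : (0 : ℝ) < (n : ℝ) ^ (-α) := by positivity
  have := isProbabilityMeasure_clockLaw (ι := Sym2 (Fin n)) hr
  have := isProbabilityMeasure_clockLaw (ι := Sym2 (Fin n)) one_pos
  have hpos : (0 : ℝ) < Fintype.card (CayleyTree n) :=
    lt_of_lt_of_le (by positivity) (le_card_cayleyTree hn)
  have : Nonempty (CayleyTree n) := Fintype.card_pos_iff.1 (by exact_mod_cast hpos)
  have := isProbabilityMeasure_uniformOn (Set.finite_univ (α := CayleyTree n)) Set.univ_nonempty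
  unfold fireLaw
  infer_instance

theorem tendsto_supercritical {α ε : ℝ} (hα : 1 / 2 < α) (hε : 0 < ε) (hε1 : ε < 1) :
    Tendsto (fun n : ℕ => (fireLaw α n).real (largeComponentEvent n ((1 - ε) * (n : ℝ)))ᶜ)
      atTop (𝓝 0) := by
  have hs : 0 < α - 1 / 2 := by linarith
  have hlog : Tendsto (fun x : ℝ => Real.log x / x ^ (α - 1 / 2)) atTop (𝓝 0) :=
    (isLittleO_log_rpow_atTop hs).tendsto_div_nhds_zero
  have hlim : Tendsto (fun x : ℝ => (7 * x ^ (-(α - 1 / 2)) +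
      2 * (Real.log x / x ^ (α - 1 / 2))) / ε) atTop (𝓝 ((7 * 0 + 2 * 0) / ε)) :=
    (((tendsto_rpow_neg_atTop hs).const_mul 7).add (hlog.const_mul 2)).div_const ε
  simp only [mul_zero, add_zero, zero_div] at hlim
  refine squeeze_zero' (Eventually.of_forall fun _ => measureReal_nonneg) ?_
    (hlim.comp tendsto_natCast_atTop_atTop)
  filter_upwards [eventually_gt_atTop 0] with n hn
  refine (fireLaw_small_le hn hε hε1).trans (le_of_eq ?_)
  have hn' : (0 : ℝ) < n := by exact_mod_cast hn
  simp only [Function.comp]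
  rw [Real.sqrt_eq_rpow, ← mul_assoc, ← Real.rpow_add hn', Real.rpow_neg hn'.le,
    show -α + 1 / 2 = -(α - 1 / 2) by ring, Real.rpow_neg hn'.le]
  ring

theorem exists_harmonic_large (x : ℝ) :
    ∃ H : ℕ, 1 ≤ H ∧ x ≤ ∑ h ∈ Finset.Icc 1 H, 1 / (h : ℝ) := by
  have h1 : Tendsto (fun H : ℕ => Real.log ((H : ℝ) + 1)) atTop atTop :=
    Real.tendsto_log_atTop.comp (tendsto_atTop_add_const_right _ 1 tendsto_natCast_atTop_atTop)
  obtain ⟨H, hH, hx⟩ := ((eventually_ge_atTop 1).and (h1.eventually_ge_atTop x)).exists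
  refine ⟨H, hH, hx.trans ?_⟩
  have h2 := log_add_one_le_harmonic H
  have h3 : ((harmonic H : ℚ) : ℝ) = ∑ h ∈ Finset.Icc 1 H, 1 / (h : ℝ) := by
    rw [harmonic_eq_sum_Icc]
    push_cast
    simp
  rw [h3] at h2
  exact_mod_cast h2

theorem tendsto_critical {ε : ℝ} (hε : 0 < ε) :
    Tendsto (fun n : ℕ => (fireLaw (1 / 2) n).real (largeComponentEvent n (ε * (n : ℝ))))
      atTop (𝓝 0) := by
  refine tendsto_order.2 ⟨fun b hb => Eventually.of_forall fun n =>
    hb.trans_le measureReal_nonneg, fun τ hτ => ?_⟩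
  -- A quarter of the budget goes to each of δ², 2/a, the exponential, and the terms vanishing as n
  -- grows.
  set κ := τ * ε ^ 2 / 4 with hκ
  have hκ0 : 0 < κ := by positivity
  set δ := √κ with hδ
  have hδ0 : 0 < δ := Real.sqrt_pos.2 hκ0
  have hδ2 : δ ^ 2 = κ := Real.sq_sqrt hκ0.le
  set a := 2 / κ with ha
  have ha0 : 0 < a := by positivity
  have hq : 0 < Real.exp (-1) * δ / 2 := by positivity
  -- H depends on τ and ε only, so the terms polynomial in H vanish as n tends to infinity.
  obtain ⟨H, hH1, hH⟩ := exists_harmonic_large (-Real.log κ / (Real.exp (-1) * δ / 2))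
  have hexp : Real.exp (-(Real.exp (-1) * δ / 2 * ∑ h ∈ Finset.Icc 1 H, 1 / (h : ℝ))) ≤ κ := by
    rw [div_le_iff₀ hq] at hH
    calc _ ≤ Real.exp (Real.log κ) := Real.exp_le_exp.2 (by linarith)
      _ = κ := Real.exp_log hκ0
  have hsqrt : Tendsto (fun n : ℕ => √(n : ℝ)) atTop atTop :=
    Real.tendsto_sqrt_atTop.comp tendsto_natCast_atTop_atTop
  have hinv : Tendsto (fun n : ℕ => (√(n : ℝ))⁻¹) atTop (𝓝 0) :=
    tendsto_inv_atTop_zero.comp hsqrt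
  have hlim1 : Tendsto (fun n : ℕ => (a * √(n : ℝ) + H) / n) atTop (𝓝 0) := by
    have h1 : Tendsto (fun n : ℕ => a * (√(n : ℝ))⁻¹ + H * ((√(n : ℝ))⁻¹ * (√(n : ℝ))⁻¹)) atTop
        (𝓝 (a * 0 + H * (0 * 0))) := (hinv.const_mul a).add ((hinv.mul hinv).const_mul _)
    simp only [mul_zero, add_zero] at h1
    refine h1.congr' ?_
    filter_upwards [eventually_gt_atTop 0] with n hn
    have hn' : (0 : ℝ) < n := by exact_mod_cast hn
    have hs : 0 < √(n : ℝ) := Real.sqrt_pos.2 hn'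
    nth_rewrite 5 [← Real.mul_self_sqrt hn'.le]
    field_simp
  have hlim2 : Tendsto (fun n : ℕ => 88 * ((H : ℝ) + 1) ^ 3 / (δ * √(n : ℝ)) +
      8 * H * (a * √(n : ℝ) + H) / n) atTop (𝓝 0) := by
    have h1 := (hinv.const_mul (88 * ((H : ℝ) + 1) ^ 3 / δ)).add (hlim1.const_mul (8 * (H : ℝ)))
    simp only [mul_zero, add_zero] at h1
    refine h1.congr fun n => ?_
    rw [← div_eq_mul_inv, div_div, ← mul_div_assoc (8 * (H : ℝ))]
  have hlim3 : Tendsto (fun n : ℕ => (H : ℝ) * ((a * √(n : ℝ) + H) / n)) atTop (𝓝 0) := by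
    simpa using hlim1.const_mul (H : ℝ)
  filter_upwards [eventually_gt_atTop 0, (tendsto_order.1 hlim2).2 κ hκ0,
    (tendsto_order.1 hlim3).2 1 one_pos] with n hn h2 h3
  have hn' : (0 : ℝ) < n := by exact_mod_cast hn
  have hHn : (H : ℝ) * (a * √(n : ℝ) + H) ≤ n := by
    rw [← mul_div_assoc, div_lt_one hn'] at h3
    exact h3.le
  refine (fireLaw_large_le hn hε hδ0 ha0 hH1 hHn).trans_lt ?_
  rw [div_lt_iff₀ (by positivity)]
  have h4 : 2 / a = κ := by rw [ha]; field_simp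
  rw [hδ2, h4]
  have h5 : τ * ε ^ 2 = 4 * κ := by rw [hκ]; ring
  rw [h5]
  linarith

end Limits

end FireTree

theorem corollary1 (ε : ℝ) (hε0 : 0 < ε) (hε1 : ε < 1) :
    (∀ α : ℝ, 1 / 2 < α →
      Tendsto (fun n : ℕ => FireTree.fireLaw α n
        (FireTree.largeComponentEvent n ((1 - ε) * (n : ℝ)))) atTop (𝓝 1)) ∧
    (Tendsto (fun n : ℕ => FireTree.fireLaw (1 / 2) n
        (FireTree.largeComponentEvent n (ε * (n : ℝ)))) atTop (𝓝 0)) := by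
  constructor
  · intro α hα
    have h1 := ENNReal.tendsto_ofReal (FireTree.tendsto_supercritical hα hε0 hε1)
    rw [ENNReal.ofReal_zero] at h1
    have h2 := ENNReal.Tendsto.sub tendsto_const_nhds h1 (Or.inl ENNReal.one_ne_top)
    rw [tsub_zero] at h2
    refine tendsto_of_tendsto_of_tendsto_of_le_of_le' h2 tendsto_const_nhds ?_ ?_
    · filter_upwards [eventually_gt_atTop 0] with n hn
      have := FireTree.isProbabilityMeasure_fireLaw α hn
      -- Subadditivity gives 1 ≤ P(E) + P(Eᶜ) without measurability of the event E.
      rw [ofReal_measureReal, tsub_le_iff_right, ← measure_univ (μ := FireTree.fireLaw α n),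
        ← Set.union_compl_self]
      exact measure_union_le _ _
    · filter_upwards [eventually_gt_atTop 0] with n hn
      have := FireTree.isProbabilityMeasure_fireLaw α hn
      exact prob_le_one
  · have h1 := ENNReal.tendsto_ofReal (FireTree.tendsto_critical hε0)
    rw [ENNReal.ofReal_zero] at h1
    refine h1.congr' ?_
    filter_upwards [eventually_gt_atTop 0] with n hn
    have := FireTree.isProbabilityMeasure_fireLaw (1 / 2) hn
    exact ofReal_measureReal
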